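/- **Setting.** Let $n\ge 0$, let $f:\mathbb R^n\to\mathbb R$ be twice continuously differentiable, $\psi:\mathbb R^n\to\mathbb R\cup\{+\infty\}$ proper, closed and convex, $Q=\operatorname{dom}\psi$, $F=f+\psi$. Norms are Euclidean (spectral for matrices). Assume, for some $L\ge 0$ and $\mu>0$, * (A1) $\|\nabla^2 f(y)-\nabla^2 f(x)\|\le L\|y-x\|$ for all $x,y\in\mathbb R^n$; * (A2) $\nabla^2 f(x)\succeq\mu I$ for all $x\in Q$. **Procedure** $\mathrm{ZeroOrderCubicSteps}(x,B,\sigma,m,\epsilon)$. Set $x(0)=x$, $h_g=3^{-1/3}\bigl[\epsilon m/(\sigma n^{1/2})\bigr]^{1/2}$. For $t=0,1,\dots,m-1$: let $g_t^{(i)}=\frac{f(x(t)+h_ge_i)-f(x(t)-h_ge_i)}{2h_g}$ and $M(y)=f(x(t))+\langle g_t,y-x(t)\rangle+\frac12\langle B(y-x(t)),y-x(t)\rangle+\frac\sigma6\|y-x(t)\|^3$; choose any $x(t+1)\in Q$ and $\psi'(x(t+1))\in\partial\psi(x(t+1))$ with $$M(x(t+1))+\psi(x(t+1))\le F(x(t)),\qquad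 \|\nabla M(x(t+1))+\psi'(x(t+1))\|\le\tfrac\sigma4\|x(t+1)-x(t)\|^2 .$$ If $F(x(0))-F(x(t+1))<\frac{\epsilon^{3/2}}{384\,\sigma^{1/2}}(t+1)$, stop and return $(x(t+1),\mathtt{halt})$. If all $m$ steps pass this test, return $(x(m),\mathtt{success})$. **Zeroth-order CNM.** Given $x_0\in Q$, $\tau_0>0$, $\epsilon>0$, an integer $m\ge1$. At iteration $k=0,1,\dots$, for $\ell=0,1,\dots$ put $$\sigma_{k,\ell}=2^4\bigl(\tfrac23\bigr)^{1/3}(2^\ell\tau_k)m,\qquad h=h_{k,\ell}=\Bigl[\tfrac{3^4\sigma_{k,\ell}^{3/2}\epsilon^{3/2}}{2^{14}\cdot192\,n^3(2^\ell\tau_k)^3}\Bigr]^{1/3},\qquad B_{k,\ell}=\tfrac12(A+A^\top),$$ $$A^{(i,j)}=\frac{f(x_k+he_i+he_j)-f(x_k+he_i)-f(x_k+he_j)+f(x_k)}{h^2},$$ and run $\mathrm{ZeroOrderCubicSteps}(x_k,B_{k,\ell},\sigma_{k,\ell},m,\epsilon)$, with iterates $x_{k,\ell}(t)$. On $\mathtt{halt}$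 increase $\ell$ by one and repeat. On the first $\mathtt{success}$, at $\ell=\ell_k$, set $x_{k+1}=x_{k,\ell_k}(m)$ and $\tau_{k+1}=\max\{\tau_0,2^{\ell_k-1}\tau_k\}$ and go to iteration $k+1$. (There is no stopping rule; the loop over $\ell$ in an iteration may be infinite.) The point $x_{k+1}$ keeps the subgradient $\psi'(x_{k,\ell_k}(m))$; a subgradient $\psi'(x_0)\in\partial\psi(x_0)$ is given with $x_0$. **Theorem.** Let $$c=\frac1{3^{1/6}2^{13/6}},\quad c_g=\frac1{3^{1/3}2^2(2/3)^{1/6}},\quad \kappa=\frac{\mu^2}{2}\Bigl[3\cdot2^6\bigl(\tfrac23\bigr)^{1/3}m\max\{\tau_0,L\}+8L+\frac{c^2L^2m}{\tau_0}\Bigr]^{-1}.$$ Assume A1, A2, $\tau_0\ge\frac{2c_g^2L}{3}$, and $\epsilon\le\|\nabla f(x_0)+\psi'(x_0)\|\le\frac\kappa2$ (that is, $x_0\in\mathcal Q_{\epsilon,\kappa}$). Then, for every execution of the zeroth-order CNM, there is an iteration in which some computed iterate satisfies $\|\nabla f(x_{k,\ell}(t))+\psi'(x_{k,\ell}(t))\|\le\epsilon$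 (for some $\ell\ge0$ and $t\in\{0,\dots,m\}$), where $\psi'(x_{k,\ell}(t))$ is the subgradient attached to that iterate, and the first index $k=T(\epsilon)$ of such an iteration satisfies $$T(\epsilon)\le\frac{1}{\log_2(1+m)}\log_2\log_2\frac\kappa\epsilon+1 .$$ -/

import Mathlib

namespace ZOCNM

noncomputable section

/-- The space `ℝⁿ` with the standard Euclidean norm. -/
abbrev E (n : ℕ) : Type := EuclideanSpace ℝ (Fin n)

/-- The standard basis vector `e_i` of `ℝⁿ`. -/
def basisVec {n : ℕ} (i : Fin n) : E n := EuclideanSpace.single i (1 : ℝ)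

/-! ### The composite problem: minimize `F = f + ψ` over `Q = dom ψ` -/

/-- A proper, closed (lower semicontinuous), convex function `ψ : ℝⁿ → ℝ ∪ {+∞}`;
convexity is convexity of the epigraph. -/
structure IsProperClosedConvex {n : ℕ} (ψ : E n → EReal) : Prop where
  ne_bot : ∀ x, ψ x ≠ ⊥
  exists_ne_top : ∃ x, ψ x ≠ ⊤
  closed : LowerSemicontinuous ψ
  convex : Convex ℝ {q : E n × ℝ | ψ q.1 ≤ (q.2 : EReal)}

/-- The effective domain `Q = dom ψ`. -/
def effDomain {n : ℕ} (ψ : E n → EReal) : Set (E n) := {x | ψ x ≠ ⊤}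

/-- The subdifferential `∂ψ(x)` of convex analysis at a point `x` of the effective domain;
it is empty outside the domain. -/
def subdifferential {n : ℕ} (ψ : E n → EReal) (x : E n) : Set (E n) :=
  {s | x ∈ effDomain ψ ∧ ∀ y, ψ x + ((inner ℝ s (y - x) : ℝ) : EReal) ≤ ψ y}

/-- The composite objective `F = f + ψ`. -/
def objective {n : ℕ} (f : E n → ℝ) (ψ : E n → EReal) (x : E n) : EReal :=
  ((f x : ℝ) : EReal) + ψ x

/-- The Hessian `∇²f(x)`, as a continuous linear operator (so that its norm is the spectral
norm). -/
def hessian {n : ℕ} (f : E n → ℝ) (x : E n) : E n →L[ℝ] E n :=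
  fderiv ℝ (gradient f) x

/-- Assumption A1: the Hessian of `f` is Lipschitz continuous on `ℝⁿ` with constant `L`. -/
def HessianLipschitz {n : ℕ} (f : E n → ℝ) (L : ℝ) : Prop :=
  ∀ x y : E n, ‖hessian f y - hessian f x‖ ≤ L * ‖y - x‖

/-- Assumption A2: `∇²f(x) ⪰ μ I` for all `x ∈ Q`. -/
def HessianBoundedBelow {n : ℕ} (f : E n → ℝ) (Q : Set (E n)) (μ : ℝ) : Prop :=
  ∀ x ∈ Q, ∀ v : E n, μ * ‖v‖ ^ 2 ≤ inner ℝ (hessian f x v) v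

/-! ### Finite differences -/

/-- Central-difference approximation of the gradient with parameter `h`. -/
def fdGradient {n : ℕ} (f : E n → ℝ) (h : ℝ) (x : E n) : E n :=
  WithLp.toLp 2 (fun i => (f (x + h • basisVec i) - f (x - h • basisVec i)) / (2 * h))

/-- The matrix of second-order forward differences of `f` at `x` with parameter `h`. -/
def fdHessianRaw {n : ℕ} (f : E n → ℝ) (h : ℝ) (x : E n) : Matrix (Fin n) (Fin n) ℝ :=
  Matrix.of (fun i j =>
    (f (x + h • basisVec i + h • basisVec j) - f (x + h • basisVec i)
      - f (x + h • basisVec j) + f x) / h ^ 2)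

/-- The symmetrized approximation `B = (A + Aᵀ) / 2` of the Hessian. -/
def fdHessian {n : ℕ} (f : E n → ℝ) (h : ℝ) (x : E n) : Matrix (Fin n) (Fin n) ℝ :=
  (1 / 2 : ℝ) • (fdHessianRaw f h x + (fdHessianRaw f h x).transpose)

/-! ### One inexact cubic Newton step -/

/-- The cubically regularized model
`M(y) = f(x) + ⟨g, y - x⟩ + ⟨B (y - x), y - x⟩ / 2 + σ ‖y - x‖³ / 6`. -/
def cubicModel {n : ℕ} (f : E n → ℝ) (g : E n) (B : Matrix (Fin n) (Fin n) ℝ) (σ : ℝ)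
    (x y : E n) : ℝ :=
  f x + inner ℝ g (y - x)
    + (1 / 2) * inner ℝ (Matrix.toEuclideanCLM (𝕜 := ℝ) B (y - x)) (y - x)
    + (σ / 6) * ‖y - x‖ ^ 3

/-- `xp`, together with the subgradient `sp ∈ ∂ψ(xp)`, is an admissible approximate minimizer of
`M + ψ`: `M(xp) + ψ(xp) ≤ F(x)` and `‖∇M(xp) + sp‖ ≤ σ ‖xp - x‖² / 4`. -/
structure IsInexactStep {n : ℕ} (f : E n → ℝ) (ψ : E n → EReal) (g : E n)
    (B : Matrix (Fin n) (Fin n) ℝ) (σ : ℝ) (x xp sp : E n) : Prop where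
  model_le : ((cubicModel f g B σ x xp : ℝ) : EReal) + ψ xp ≤ objective f ψ x
  mem_subdifferential : sp ∈ subdifferential ψ xp
  stationary : ‖gradient (cubicModel f g B σ x) xp + sp‖ ≤ σ / 4 * ‖xp - x‖ ^ 2

/-! ### The procedure `ZeroOrderCubicSteps(x, B, σ, m, ε)`

A call is described by its iterates `y 0, y 1, …` and the subgradients `p t ∈ ∂ψ(y t)` attached to
them; only the entries that are actually computed in the call are meaningful. -/

/-- The finite-difference parameter `h_g = 3^(-1/3) (ε m / (σ √n))^(1/2)`. -/
def gradStep (n m : ℕ) (ε σ : ℝ) : ℝ :=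
  1 / (3 : ℝ) ^ (1 / 3 : ℝ) * ((ε * m) / (σ * (n : ℝ) ^ (1 / 2 : ℝ))) ^ (1 / 2 : ℝ)

/-- The test performed right after the `j`-th iterate (`j ≥ 1`) is computed:
`F(y 0) - F(y j) ≥ j ε^(3/2) / (384 σ^(1/2))`. -/
def PassesTest {n : ℕ} (f : E n → ℝ) (ψ : E n → EReal) (σ ε : ℝ) (y : ℕ → E n) (j : ℕ) : Prop :=
  ((ε ^ (3 / 2 : ℝ) / (384 * σ ^ (1 / 2 : ℝ)) * (j : ℝ) : ℝ) : EReal)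
    ≤ objective f ψ (y 0) - objective f ψ (y j)

/-- The `t`-th iterate is computed in the call: `t ≤ m` and the call was not halted before. -/
def IterateComputed {n : ℕ} (f : E n → ℝ) (ψ : E n → EReal) (σ : ℝ) (m : ℕ) (ε : ℝ)
    (y : ℕ → E n) (t : ℕ) : Prop :=
  t ≤ m ∧ ∀ j, 1 ≤ j → j < t → PassesTest f ψ σ ε y j

/-- The call returns `success`; otherwise it returns `halt`. -/
def Succeeds {n : ℕ} (f : E n → ℝ) (ψ : E n → EReal) (σ : ℝ) (m : ℕ) (ε : ℝ)
    (y : ℕ → E n) : Prop :=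
  ∀ j, 1 ≤ j → j ≤ m → PassesTest f ψ σ ε y j

/-- `y`, `p` are the iterates and subgradients of a call of `ZeroOrderCubicSteps` started at the
point `x`, to which the subgradient `s` is attached. -/
structure IsZeroOrderCubicSteps {n : ℕ} (f : E n → ℝ) (ψ : E n → EReal) (x s : E n)
    (B : Matrix (Fin n) (Fin n) ℝ) (σ : ℝ) (m : ℕ) (ε : ℝ) (y p : ℕ → E n) : Prop where
  y_zero : y 0 = x
  p_zero : p 0 = s
  step : ∀ t, IterateComputed f ψ σ m ε y (t + 1) →
    IsInexactStep f ψ (fdGradient f (gradStep n m ε σ) (y t)) B σ (y t) (y (t + 1)) (p (t + 1))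

/-! ### The zeroth-order cubic Newton method -/

/-- `σ_{k,ℓ} = 2⁴ (2/3)^(1/3) (2^ℓ τ_k) m`. -/
def regParam (m : ℕ) (τ : ℝ) (l : ℕ) : ℝ :=
  2 ^ 4 * (2 / 3 : ℝ) ^ (1 / 3 : ℝ) * (2 ^ l * τ) * m

/-- `h_{k,ℓ} = (3⁴ σ_{k,ℓ}^(3/2) ε^(3/2) / (2¹⁴ · 192 · n³ (2^ℓ τ_k)³))^(1/3)`. -/
def hessStep (n m : ℕ) (ε τ : ℝ) (l : ℕ) : ℝ :=
  ((3 ^ 4 * (regParam m τ l) ^ (3 / 2 : ℝ) * ε ^ (3 / 2 : ℝ)) /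
    (2 ^ 14 * 192 * (n : ℝ) ^ 3 * (2 ^ l * τ) ^ 3)) ^ (1 / 3 : ℝ)

/-- The data produced by an execution: outer iterates `x k`, with attached subgradients `s k`,
parameters `τ k`, and, for the call in the `l`-th inner loop of iteration `k`, its iterates
`y k l t` (that is, `x_{k,l}(t)`) with attached subgradients `p k l t`. Entries that the execution
never computes are irrelevant. -/
structure Trace (n : ℕ) where
  x : ℕ → E n
  s : ℕ → E n
  τ : ℕ → ℝ
  y : ℕ → ℕ → ℕ → E n
  p : ℕ → ℕ → ℕ → E n

variable {n : ℕ}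

/-- The call number `l` of iteration `k` returns `success`. -/
def Trace.CallSucceeds (r : Trace n) (f : E n → ℝ) (ψ : E n → EReal) (m : ℕ) (ε : ℝ)
    (k l : ℕ) : Prop :=
  Succeeds f ψ (regParam m (r.τ k) l) m ε (r.y k l)

/-- The call number `l` of iteration `k` takes place: the adaptive search of every earlier
iteration ended with a success, and all earlier calls of iteration `k` were halted. (The
search of an iteration need not end: then all its calls take place and no later iteration is
started.) -/
def Trace.CallExecuted (r : Trace n) (f : E n → ℝ) (ψ : E n → EReal) (m : ℕ) (ε : ℝ)
    (k l : ℕ) : Prop :=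
  (∀ k' < k, ∃ l', r.CallSucceeds f ψ m ε k' l') ∧ ∀ l' < l, ¬ r.CallSucceeds f ψ m ε k l'

/-- The iterate `x_{k,l}(t)` is computed by the execution. -/
def Trace.Computed (r : Trace n) (f : E n → ℝ) (ψ : E n → EReal) (m : ℕ) (ε : ℝ)
    (k l t : ℕ) : Prop :=
  r.CallExecuted f ψ m ε k l ∧
    IterateComputed f ψ (regParam m (r.τ k) l) m ε (r.y k l) t

/-- `r` is an execution of the zeroth-order cubic Newton method started at the point `x₀`, to
which the subgradient `s₀` is attached. -/
structure IsZeroOrderCNM (f : E n → ℝ) (ψ : E n → EReal) (x₀ s₀ : E n) (τ₀ ε : ℝ) (m : ℕ)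
    (r : Trace n) : Prop where
  x_zero : r.x 0 = x₀
  s_zero : r.s 0 = s₀
  τ_zero : r.τ 0 = τ₀
  call : ∀ k l, r.CallExecuted f ψ m ε k l →
    IsZeroOrderCubicSteps f ψ (r.x k) (r.s k)
      (fdHessian f (hessStep n m ε (r.τ k) l) (r.x k))
      (regParam m (r.τ k) l) m ε (r.y k l) (r.p k l)
  next : ∀ k l, r.CallExecuted f ψ m ε k l → r.CallSucceeds f ψ m ε k l →
    r.x (k + 1) = r.y k l m ∧ r.s (k + 1) = r.p k l m ∧
      r.τ (k + 1) = max τ₀ ((2 : ℝ) ^ ((l : ℤ) - 1) * r.τ k)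

/-- `k` is the index of an iteration in which some computed iterate `x_{k,l}(t)` satisfies
`‖∇f(x_{k,l}(t)) + ψ'(x_{k,l}(t))‖ ≤ ε`. -/
def Trace.HitsAt (r : Trace n) (f : E n → ℝ) (ψ : E n → EReal) (m : ℕ) (ε : ℝ) (k : ℕ) : Prop :=
  ∃ l t, r.Computed f ψ m ε k l t ∧ ‖gradient f (r.y k l t) + r.p k l t‖ ≤ ε

/-! ### Constants and the local region -/

/-- `c = 1 / (3^(1/6) 2^(13/6))`. -/
def cConst : ℝ := 1 / ((3 : ℝ) ^ (1 / 6 : ℝ) * (2 : ℝ) ^ (13 / 6 : ℝ))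

/-- `c_g = 1 / (3^(1/3) 2² (2/3)^(1/6))`. -/
def cgConst : ℝ := 1 / ((3 : ℝ) ^ (1 / 3 : ℝ) * 2 ^ 2 * (2 / 3 : ℝ) ^ (1 / 6 : ℝ))

/-- The radius `κ` of the region of local convergence. -/
def kappa (μ L τ₀ : ℝ) (m : ℕ) : ℝ :=
  μ ^ 2 * (1 / 2) *
    (3 * 2 ^ 6 * (2 / 3 : ℝ) ^ (1 / 3 : ℝ) * m * max τ₀ L + 8 * L
      + cConst ^ 2 * L ^ 2 * m / τ₀)⁻¹

/-- `x ∈ 𝒬_{ε,κ}` with the selected subgradient `F'(x) = ∇f(x) + s`, `s ∈ ∂ψ(x)`: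
`x ∈ Q` and `ε ≤ ‖F'(x)‖ ≤ κ / 2`. -/
structure InLocalRegion (f : E n → ℝ) (ψ : E n → EReal) (ε κ : ℝ) (x s : E n) : Prop where
  mem_domain : x ∈ effDomain ψ
  mem_subdifferential : s ∈ subdifferential ψ x
  le_norm : ε ≤ ‖gradient f x + s‖
  norm_le : ‖gradient f x + s‖ ≤ κ / 2

end

end ZOCNM

/-! Suppose that no iterate computed so far has composite gradient norm at most `ε`. Two facts then
hold.

The adaptive search ends. Within a call the matrix `B` is frozen at the starting point, so its error
at a later iterate is `L n h` plus `L` times the distance travelled. Once `2 ^ l * τ ≥ L`, the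
factor `m` in `σ` absorbs this drift over `m` steps. Large gradients force long steps and long steps
force decrease; both effects are measured by the sum of the cubed step lengths (`le_sum_decrease`).
Hence every test passes (`IsZeroOrderCubicSteps.succeeds`), and at the first success `2 ^ l * τ ≤ 2
* max τ₀ L`, which bounds `σ`.

A successful call contracts superlinearly. The lower Hessian bound on `Q` and monotonicity of the
subdifferential limit the step length to `2 a / μ`, where `a` is the current gradient norm. The next
norm `b` then satisfies `κ b ≤ a a₀`, with `a₀` the norm at the start of the call (`local_step`).
After `m` steps the ratio of the norm to `κ` has been raised to the power `m + 1`. Starting from at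
most `1/2`, the norm at the start of iteration `k` is at most `κ (1/2) ^ (1 + m) ^ k`
(`IsZeroOrderCNM.convergence_before_hit`). It is also at least `ε`, and two logarithms bound `k`. -/

namespace ZOCNM

/-! ### Taylor estimates -/

/-- A curve that starts at the origin and whose speed at time `t` is at most `a + b t + c t²` is
at distance at most `a + b / 2 + c / 3` from the origin at time `1`. -/
lemma norm_le_of_norm_deriv_le {V : Type*} [NormedAddCommGroup V] [NormedSpace ℝ V]
    {φ φ' : ℝ → V} {a b c : ℝ} (h0 : φ 0 = 0) (hφ : ∀ t, HasDerivAt φ (φ' t) t)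
    (bound : ∀ t, 0 ≤ t → t ≤ 1 → ‖φ' t‖ ≤ a + b * t + c * t ^ 2) :
    ‖φ 1‖ ≤ a + b / 2 + c / 3 := by
  have key := image_norm_le_of_norm_deriv_right_le_deriv_boundary (f := φ) (f' := φ') (a := 0)
    (b := 1) (B := fun t => a * t + b / 2 * t ^ 2 + c / 3 * t ^ 3)
    (B' := fun t => a + b * t + c * t ^ 2)
    (fun t _ => (hφ t).continuousAt.continuousWithinAt)
    (fun t _ => (hφ t).hasDerivWithinAt) (by simp [h0])
    (fun t => by
      have := (((hasDerivAt_id t).const_mul a).add ((hasDerivAt_pow 2 t).const_mul (b / 2))).add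
        ((hasDerivAt_pow 3 t).const_mul (c / 3))
      refine this.congr_deriv ?_
      simp only [Nat.cast_ofNat]
      ring)
    (fun t ht => bound t ht.1 ht.2.le) (x := 1) (by simp)
  simpa using key

section Smooth

variable {n : ℕ} {f : E n → ℝ} {L : ℝ}

lemma hasFDerivAt_of_contDiff (hf : ContDiff ℝ 2 f) (x : E n) :
    HasFDerivAt f (InnerProductSpace.toDual ℝ (E n) (gradient f x)) x :=
  ((hf.differentiable (by norm_num)) x).hasGradientAt.hasFDerivAt

lemma hasFDerivAt_gradient (hf : ContDiff ℝ 2 f) (x : E n) :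
    HasFDerivAt (gradient f) (hessian f x) x := by
  have h1 : ContDiff ℝ 1 (fderiv ℝ f) := hf.fderiv_right (by norm_num)
  have h2 : DifferentiableAt ℝ (fderiv ℝ f) x := (h1.differentiable (by norm_num)) x
  have h3 : DifferentiableAt ℝ (gradient f) x :=
    ((InnerProductSpace.toDual ℝ (E n)).symm.toContinuousLinearEquiv.differentiableAt).comp x h2
  exact h3.hasFDerivAt

lemma inner_hessian_comm (hf : ContDiff ℝ 2 f) (x u v : E n) :
    inner ℝ (hessian f x u) v = inner ℝ (hessian f x v) u := by
  have hsymm : IsSymmSndFDerivAt ℝ f x := hf.contDiffAt.isSymmSndFDerivAt (by simp)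
  have h1 : ContDiff ℝ 1 (fderiv ℝ f) := hf.fderiv_right (by norm_num)
  have h2 : DifferentiableAt ℝ (fderiv ℝ f) x := (h1.differentiable (by norm_num)) x
  have key : ∀ u v : E n, inner ℝ (hessian f x u) v = fderiv ℝ (fderiv ℝ f) x u v := by
    intro u v
    have h3 : HasFDerivAt (fun y => inner ℝ (gradient f y) v)
        ((innerSL ℝ v).comp (hessian f x)) x := by
      have := (innerSL ℝ v).hasFDerivAt.comp x (hasFDerivAt_gradient hf x)
      refine this.congr_of_eventuallyEq (Filter.Eventually.of_forall fun y => ?_)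
      simp
    have h4 : HasFDerivAt (fun y => inner ℝ (gradient f y) v)
        ((fderiv ℝ (fderiv ℝ f) x).flip v) x := by
      have := h2.hasFDerivAt.clm_apply (hasFDerivAt_const v x)
      refine (this.congr_of_eventuallyEq (Filter.Eventually.of_forall fun y => ?_)).congr_fderiv ?_
      · simp [gradient]
      · ext; simp
    have := congrArg (fun T => T u) (h3.unique h4)
    simpa [real_inner_comm] using this
  rw [key, key]
  exact hsymm u v

lemma hasDerivAt_line (x d : E n) (t : ℝ) : HasDerivAt (fun t : ℝ => x + t • d) d t := by
  simpa using ((hasDerivAt_id t).smul_const d).const_add x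

lemma hasDerivAt_comp_line (hf : ContDiff ℝ 2 f) (x d : E n) (t : ℝ) :
    HasDerivAt (fun t : ℝ => f (x + t • d)) (inner ℝ (gradient f (x + t • d)) d) t := by
  exact ((hasFDerivAt_of_contDiff hf (x + t • d)).comp_hasDerivAt t
    (hasDerivAt_line x d t)).congr_deriv (InnerProductSpace.toDual_apply_apply ..)

lemma hasDerivAt_gradient_comp_line (hf : ContDiff ℝ 2 f) (x d : E n) (t : ℝ) :
    HasDerivAt (fun t : ℝ => gradient f (x + t • d)) (hessian f (x + t • d) d) t := by
  exact (hasFDerivAt_gradient hf (x + t • d)).comp_hasDerivAt t (hasDerivAt_line x d t)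

lemma HessianLipschitz.norm_apply_sub_le (A1 : HessianLipschitz f L) (x y v : E n) :
    ‖hessian f y v - hessian f x v‖ ≤ L * ‖y - x‖ * ‖v‖ := by
  rw [← sub_apply]
  exact (ContinuousLinearMap.le_opNorm _ _).trans
    (mul_le_mul_of_nonneg_right (A1 x y) (norm_nonneg _))

/-- First-order Taylor estimate for the gradient. -/
lemma norm_gradient_taylor_le (hf : ContDiff ℝ 2 f) (A1 : HessianLipschitz f L) (x d : E n) :
    ‖gradient f (x + d) - gradient f x - hessian f x d‖ ≤ L / 2 * ‖d‖ ^ 2 := by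
  have key := norm_le_of_norm_deriv_le (a := 0) (b := L * ‖d‖ ^ 2) (c := 0)
    (φ := fun t : ℝ => gradient f (x + t • d) - gradient f x - t • hessian f x d)
    (φ' := fun t => hessian f (x + t • d) d - hessian f x d) (by simp)
    (fun t => by
      exact (((hasDerivAt_gradient_comp_line hf x d t).sub_const (gradient f x)).sub
        ((hasDerivAt_id t).smul_const (hessian f x d))).congr_deriv (by rw [one_smul]))
    (fun t h0 _ => by
      have := A1.norm_apply_sub_le x (x + t • d) d
      simp only [add_sub_cancel_left, norm_smul, Real.norm_eq_abs, abs_of_nonneg h0] at this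
      linarith)
  simp only [one_smul] at key
  linarith

/-- Second-order Taylor estimate for the function. -/
lemma abs_taylor_le (hf : ContDiff ℝ 2 f) (A1 : HessianLipschitz f L) (x d : E n) :
    |f (x + d) - f x - inner ℝ (gradient f x) d - 1 / 2 * inner ℝ (hessian f x d) d|
      ≤ L / 6 * ‖d‖ ^ 3 := by
  have key := norm_le_of_norm_deriv_le (a := 0) (b := 0) (c := L / 2 * ‖d‖ ^ 3)
    (φ := fun t : ℝ => f (x + t • d) - f x - t * inner ℝ (gradient f x) d
      - t ^ 2 * (1 / 2 * inner ℝ (hessian f x d) d))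
    (φ' := fun t => inner ℝ (gradient f (x + t • d) - gradient f x - hessian f x (t • d)) d)
    (by simp)
    (fun t => by
      have := (((hasDerivAt_comp_line hf x d t).sub_const (f x)).sub
        ((hasDerivAt_id t).mul_const (inner ℝ (gradient f x) d))).sub
        ((hasDerivAt_pow 2 t).mul_const (1 / 2 * inner ℝ (hessian f x d) d))
      refine this.congr_deriv ?_
      simp only [inner_sub_left, map_smul, real_inner_smul_left, Nat.cast_ofNat]
      ring)
    (fun t h0 _ => by
      have h1 := norm_gradient_taylor_le hf A1 x (t • d)
      have h2 := norm_inner_le_norm (𝕜 := ℝ)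
        (gradient f (x + t • d) - gradient f x - hessian f x (t • d)) d
      rw [norm_smul, Real.norm_eq_abs t, abs_of_nonneg h0] at h1
      have h3 := mul_le_mul_of_nonneg_right h1 (norm_nonneg d)
      nlinarith [h2, h3])
  simp only [one_smul, one_mul, one_pow, Real.norm_eq_abs] at key
  linarith

/-- A mixed second difference approximates the Hessian form. -/
lemma abs_second_difference_sub_le (hf : ContDiff ℝ 2 f) (A1 : HessianLipschitz f L)
    {h : ℝ} (x a b : E n) (ha : ‖a‖ = h) (hb : ‖b‖ = h) :
    |f (x + a + b) - f (x + a) - f (x + b) + f x - inner ℝ (hessian f x b) a| ≤ L * h ^ 3 := by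
  have key := norm_le_of_norm_deriv_le (a := L / 2 * h ^ 3) (b := L * h ^ 3) (c := 0)
    (φ := fun t : ℝ => f (x + b + t • a) - f (x + t • a) - (f (x + b) - f x)
      - t * inner ℝ (hessian f x b) a)
    (φ' := fun t => inner ℝ (gradient f (x + b + t • a)) a - inner ℝ (gradient f (x + t • a)) a
      - inner ℝ (hessian f x b) a)
    (by simp)
    (fun t => by
      exact ((((hasDerivAt_comp_line hf (x + b) a t).sub
        (hasDerivAt_comp_line hf x a t)).sub_const (f (x + b) - f x)).sub
        ((hasDerivAt_id t).mul_const (inner ℝ (hessian f x b) a))).congr_deriv (by rw [one_mul]))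
    (fun t h0 _ => by
      -- The gradient increment is expanded at the moving point `x + t • a`, and the Hessian is then
      -- carried back to `x`. Integration over `t` turns the two errors into `L / 2 * h ^ 3` each.
      have h1 := norm_gradient_taylor_le hf A1 (x + t • a) b
      have h2 := A1.norm_apply_sub_le x (x + t • a) b
      have h3 : ‖gradient f (x + b + t • a) - gradient f (x + t • a) - hessian f x b‖
          ≤ L / 2 * h ^ 2 + L * h ^ 2 * t := by
        have e : gradient f (x + b + t • a) - gradient f (x + t • a) - hessian f x b
          = (gradient f (x + t • a + b) - gradient f (x + t • a) - hessian f (x + t • a) b)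
            + (hessian f (x + t • a) b - hessian f x b) := by
          rw [add_right_comm x b]; abel
        rw [e]
        refine (norm_add_le _ _).trans ?_
        rw [hb] at h1 h2
        simp only [add_sub_cancel_left, norm_smul, Real.norm_eq_abs, abs_of_nonneg h0, ha] at h2
        nlinarith
      have h4 := norm_inner_le_norm (𝕜 := ℝ)
        (gradient f (x + b + t • a) - gradient f (x + t • a) - hessian f x b) a
      rw [inner_sub_left, inner_sub_left, ha] at h4
      have hh : 0 ≤ h := ha ▸ norm_nonneg a
      have h5 := mul_le_mul_of_nonneg_right h3 hh
      refine h4.trans (h5.trans (le_of_eq ?_))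
      ring)
  simp only [one_smul, one_mul, Real.norm_eq_abs] at key
  rw [add_right_comm x b a] at key
  calc _ = |f (x + a + b) - f (x + a) - (f (x + b) - f x) - inner ℝ (hessian f x b) a| := by
        congr 1; ring
    _ ≤ _ := key
    _ = _ := by ring

/-! ### Errors of the finite differences -/

lemma norm_basisVec (i : Fin n) : ‖basisVec i‖ = 1 := by simp [basisVec]

lemma inner_basisVec_right (v : E n) (i : Fin n) : inner ℝ v (basisVec i) = v i := by
  simp [basisVec, EuclideanSpace.inner_single_right]

lemma norm_le_sqrt_mul_of_forall_abs_le {v : E n} {a : ℝ} (ha : 0 ≤ a) (h : ∀ i, |v i| ≤ a) :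
    ‖v‖ ≤ √n * a := by
  refine le_of_sq_le_sq ?_ (by positivity)
  rw [EuclideanSpace.norm_sq_eq, mul_pow, Real.sq_sqrt (Nat.cast_nonneg n)]
  calc ∑ i, ‖v i‖ ^ 2 ≤ ∑ _i : Fin n, a ^ 2 :=
        Finset.sum_le_sum fun i _ => pow_le_pow_left₀ (norm_nonneg _) (h i) 2
    _ = n * a ^ 2 := by simp

/-- Central differences cancel the second-order Taylor term, so each coordinate has an error of
order `h ^ 2`; passing to the Euclidean norm costs `√n`. -/
lemma norm_gradient_sub_fdGradient_le (hf : ContDiff ℝ 2 f) (A1 : HessianLipschitz f L)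
    (hL : 0 ≤ L) {h : ℝ} (hh : 0 < h) (x : E n) :
    ‖gradient f x - fdGradient f h x‖ ≤ √n * (L / 6 * h ^ 2) := by
  refine norm_le_sqrt_mul_of_forall_abs_le (by positivity) fun i => ?_
  have h1 := abs_taylor_le hf A1 x (h • basisVec i)
  have h2 := abs_taylor_le hf A1 x (-(h • basisVec i))
  have e1 : (gradient f x) i = inner ℝ (gradient f x) (basisVec i) :=
    (inner_basisVec_right _ _).symm
  simp only [norm_neg, norm_smul, norm_basisVec, Real.norm_eq_abs, abs_of_pos hh, map_neg,
    inner_neg_left, inner_neg_right, real_inner_smul_right, neg_neg, mul_one] at h1 h2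
  rw [← sub_eq_add_neg] at h2
  have e2 : (gradient f x - fdGradient f h x) i = inner ℝ (gradient f x) (basisVec i)
      - (f (x + h • basisVec i) - f (x - h • basisVec i)) / (2 * h) := by
    simp only [PiLp.sub_apply, e1, fdGradient]
  have e3 : inner ℝ (gradient f x) (basisVec i)
      - (f (x + h • basisVec i) - f (x - h • basisVec i)) / (2 * h)
      = (h * inner ℝ (gradient f x) (basisVec i)
      - (f (x + h • basisVec i) - f (x - h • basisVec i)) / 2) / h := by
    field_simp
  rw [e2, e3, abs_div, abs_of_pos hh, div_le_iff₀ hh]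
  rw [abs_le] at h1 h2 ⊢
  constructor <;> nlinarith [h1.1, h1.2, h2.1, h2.2]

/-- By symmetry of the Hessian, the raw entries `(i, j)` and `(j, i)` approximate the same number,
so averaging them preserves the error bound. -/
lemma abs_fdHessian_sub_le (hf : ContDiff ℝ 2 f) (A1 : HessianLipschitz f L)
    {h : ℝ} (hh : 0 < h) (x : E n) (i j : Fin n) :
    |fdHessian f h x i j - inner ℝ (hessian f x (basisVec j)) (basisVec i)| ≤ L * h := by
  have key : ∀ i j : Fin n,
      |fdHessianRaw f h x i j - inner ℝ (hessian f x (basisVec j)) (basisVec i)| ≤ L * h := by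
    intro i j
    have hn : ∀ i : Fin n, ‖h • basisVec i‖ = h := fun i => by
      rw [norm_smul, norm_basisVec, Real.norm_eq_abs, abs_of_pos hh, mul_one]
    have h1 := abs_second_difference_sub_le hf A1 x _ _ (hn i) (hn j)
    simp only [map_smul, real_inner_smul_left, real_inner_smul_right] at h1
    have e : fdHessianRaw f h x i j - inner ℝ (hessian f x (basisVec j)) (basisVec i)
        = (f (x + h • basisVec i + h • basisVec j) - f (x + h • basisVec i)
          - f (x + h • basisVec j) + f x
          - h * (h * inner ℝ (hessian f x (basisVec j)) (basisVec i))) / h ^ 2 := by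
      simp only [fdHessianRaw, Matrix.of_apply]
      field_simp
    rw [e, abs_div, abs_of_pos (pow_pos hh 2), div_le_iff₀ (pow_pos hh 2)]
    linarith
  have h1 := key i j
  have h2 := key j i
  rw [inner_hessian_comm hf] at h2
  simp only [fdHessian, Matrix.smul_apply, Matrix.add_apply, Matrix.transpose_apply, smul_eq_mul]
  rw [abs_le] at h1 h2 ⊢
  constructor <;> linarith [h1.1, h1.2, h2.1, h2.2]

lemma sum_smul_basisVec (v : E n) : v = ∑ j, v j • basisVec j := by
  ext i
  simp [basisVec, Pi.single_apply]

/-- Operator norm error of the finite-difference Hessian. -/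
lemma norm_fdHessian_sub_hessian_le (hf : ContDiff ℝ 2 f) (A1 : HessianLipschitz f L)
    (hL : 0 ≤ L) {h : ℝ} (hh : 0 < h) (x v : E n) :
    ‖Matrix.toEuclideanCLM (𝕜 := ℝ) (fdHessian f h x) v - hessian f x v‖
      ≤ L * (n * h) * ‖v‖ := by
  -- Cauchy–Schwarz gives one factor `√n` here; passing from coordinates to the norm gives the
  -- other.
  have hcs : ∑ j, |v j| ≤ √n * ‖v‖ := by
    refine le_of_sq_le_sq ?_ (by positivity)
    rw [mul_pow, Real.sq_sqrt (Nat.cast_nonneg n), EuclideanSpace.norm_sq_eq]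
    simpa using sq_sum_le_card_mul_sum_sq (s := Finset.univ) (f := fun j => |v j|)
  refine (norm_le_sqrt_mul_of_forall_abs_le (a := L * h * (√n * ‖v‖)) (by positivity)
    fun i => ?_).trans (le_of_eq ?_)
  · have e1 : (hessian f x v) i
        = ∑ j, inner ℝ (hessian f x (basisVec j)) (basisVec i) * v j := by
      rw [← inner_basisVec_right]
      conv_lhs => rw [sum_smul_basisVec v]
      rw [map_sum, sum_inner]
      exact Finset.sum_congr rfl fun j _ => by rw [map_smul, real_inner_smul_left, mul_comm]
    have e2 : (Matrix.toEuclideanCLM (𝕜 := ℝ) (fdHessian f h x) v) i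
        = ∑ j, fdHessian f h x i j * v j := by
      simp [Matrix.mulVec, dotProduct]
    rw [PiLp.sub_apply, e1, e2, ← Finset.sum_sub_distrib]
    refine (Finset.abs_sum_le_sum_abs _ _).trans ?_
    calc _ ≤ ∑ j, L * h * |v j| := Finset.sum_le_sum fun j _ => by
          rw [← sub_mul, abs_mul]
          exact mul_le_mul_of_nonneg_right (abs_fdHessian_sub_le hf A1 hh x i j) (abs_nonneg _)
      _ = L * h * ∑ j, |v j| := by rw [Finset.mul_sum]
      _ ≤ _ := mul_le_mul_of_nonneg_left hcs (by positivity)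
  · have := Real.mul_self_sqrt (Nat.cast_nonneg (α := ℝ) n)
    linear_combination L * h * ‖v‖ * this

lemma fdHessian_isSymm (f : E n → ℝ) (h : ℝ) (x : E n) : (fdHessian f h x).IsSymm := by
  ext i j
  simp only [fdHessian, Matrix.smul_apply, Matrix.add_apply, Matrix.transpose_apply]
  rw [add_comm]

end Smooth

/-! ### The cubic model -/

lemma inner_toEuclideanCLM_comm {n : ℕ} {B : Matrix (Fin n) (Fin n) ℝ} (hB : B.IsSymm)
    (u v : E n) :
    inner ℝ (Matrix.toEuclideanCLM (𝕜 := ℝ) B u) v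
      = inner ℝ (Matrix.toEuclideanCLM (𝕜 := ℝ) B v) u := by
  rw [real_inner_comm, Matrix.inner_toEuclideanCLM, real_inner_comm, Matrix.inner_toEuclideanCLM,
    Matrix.dotProduct_mulVec, ← Matrix.mulVec_transpose, hB.eq, dotProduct_comm]

lemma gradient_cubicModel {n : ℕ} (f : E n → ℝ) (g : E n) {B : Matrix (Fin n) (Fin n) ℝ}
    (hB : B.IsSymm) (σ : ℝ) (x y : E n) :
    gradient (cubicModel f g B σ x) y
      = g + Matrix.toEuclideanCLM (𝕜 := ℝ) B (y - x) + (σ / 2 * ‖y - x‖) • (y - x) := by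
  refine HasGradientAt.gradient ?_
  rw [hasGradientAt_iff_hasFDerivAt]
  have hd : HasFDerivAt (fun y : E n => y - x) (ContinuousLinearMap.id ℝ (E n)) y :=
    (hasFDerivAt_id y).sub_const x
  have h1 : HasFDerivAt (fun y : E n => inner ℝ g (y - x)) (innerSL ℝ g) y := by
    exact ((innerSL ℝ g).hasFDerivAt.comp y hd).congr_fderiv (ContinuousLinearMap.comp_id _)
  have h2 := ((Matrix.toEuclideanCLM (𝕜 := ℝ) B).hasFDerivAt.comp y hd).inner ℝ hd
  have h3 : HasFDerivAt (fun y : E n => ‖y - x‖ ^ 3)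
      ((3 * ‖y - x‖) • innerSL ℝ (y - x)) y := by
    have := (hasFDerivAt_norm_rpow (y - x) (p := 3) (by norm_num)).comp y hd
    refine (this.congr_of_eventuallyEq (Filter.Eventually.of_forall fun z => ?_)).congr_fderiv ?_
    · simp only [Function.comp]
      norm_cast
    · rw [ContinuousLinearMap.comp_id]
      norm_num
  refine ((((h1.const_add (f x)).add (h2.const_mul (1 / 2))).add
    (h3.const_mul (σ / 6)))).congr_fderiv ?_
  ext v
  have hs := inner_toEuclideanCLM_comm hB v (y - x)
  simp only [Function.comp, add_apply, smul_apply,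
    ContinuousLinearMap.comp_apply, ContinuousLinearMap.prod_apply, fderivInnerCLM_apply,
    ContinuousLinearMap.id_apply, smul_eq_mul, innerSL_apply_apply,
    InnerProductSpace.toDual_apply_apply, inner_add_left, real_inner_smul_left]
  rw [hs]
  ring


/-! ### One inexact step -/

section Step

variable {n : ℕ} {f : E n → ℝ} {ψ : E n → EReal} {L : ℝ}

lemma coe_toReal_of_mem_effDomain (hψ : IsProperClosedConvex ψ) {x : E n}
    (hx : x ∈ effDomain ψ) : (((ψ x).toReal : ℝ) : EReal) = ψ x :=
  EReal.coe_toReal hx (hψ.ne_bot x)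

lemma objective_eq_coe (hψ : IsProperClosedConvex ψ) {x : E n} (hx : x ∈ effDomain ψ) :
    objective f ψ x = ((f x + (ψ x).toReal : ℝ) : EReal) := by
  rw [objective, EReal.coe_add, coe_toReal_of_mem_effDomain hψ hx]

lemma passesTest_of_le (hψ : IsProperClosedConvex ψ) {σ ε : ℝ} {y : ℕ → E n} {j : ℕ}
    (h0 : y 0 ∈ effDomain ψ) (hj : y j ∈ effDomain ψ)
    (h : ε ^ (3 / 2 : ℝ) / (384 * σ ^ (1 / 2 : ℝ)) * (j : ℝ)
      ≤ (f (y 0) + (ψ (y 0)).toReal) - (f (y j) + (ψ (y j)).toReal)) :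
    PassesTest f ψ σ ε y j := by
  rw [PassesTest, objective_eq_coe hψ h0, objective_eq_coe hψ hj, ← EReal.coe_sub]
  exact_mod_cast h

lemma subdifferential_monotone (hψ : IsProperClosedConvex ψ) {x y s t : E n}
    (hs : s ∈ subdifferential ψ x) (ht : t ∈ subdifferential ψ y) :
    0 ≤ inner ℝ (t - s) (y - x) := by
  have h1 := hs.2 y
  have h2 := ht.2 x
  rw [← coe_toReal_of_mem_effDomain hψ hs.1, ← coe_toReal_of_mem_effDomain hψ ht.1] at h1 h2
  norm_cast at h1 h2
  rw [← neg_sub y x, inner_neg_right] at h2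
  rw [inner_sub_left]
  linarith

variable {g : E n} {B : Matrix (Fin n) (Fin n) ℝ} {σ : ℝ} {x xp s sp : E n} {β δ : ℝ}

/-- Decrease of the objective in one inexact step. -/
lemma IsInexactStep.objective_le (hstep : IsInexactStep f ψ g B σ x xp sp)
    (hψ : IsProperClosedConvex ψ) (hf : ContDiff ℝ 2 f) (A1 : HessianLipschitz f L)
    (hx : x ∈ effDomain ψ)
    (hβ : ∀ v, ‖Matrix.toEuclideanCLM (𝕜 := ℝ) B v - hessian f x v‖ ≤ β * ‖v‖)
    (hδ : ‖gradient f x - g‖ ≤ δ) :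
    f xp + (ψ xp).toReal ≤ f x + (ψ x).toReal
      - ((σ - L) / 6 * ‖xp - x‖ ^ 3 - δ * ‖xp - x‖ - β / 2 * ‖xp - x‖ ^ 2) := by
  have h1 := hstep.model_le
  rw [objective_eq_coe hψ hx, ← coe_toReal_of_mem_effDomain hψ hstep.mem_subdifferential.1,
    ← EReal.coe_add, EReal.coe_le_coe_iff] at h1
  -- The Taylor remainder `L / 6 * ‖d‖ ^ 3` is set against the cubic term of the model; what remains
  -- is the errors of `g` and `B` paired with `d`.
  have h2 := (abs_le.1 (abs_taylor_le hf A1 x (xp - x))).2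
  rw [add_sub_cancel] at h2
  set d := xp - x with hd
  have h3 := (real_inner_le_norm (gradient f x - g) d).trans
    (mul_le_mul_of_nonneg_right hδ (norm_nonneg d))
  have h4 := (abs_le.1 (abs_real_inner_le_norm
    (Matrix.toEuclideanCLM (𝕜 := ℝ) B d - hessian f x d) d)).1
  have h5 := mul_le_mul_of_nonneg_right (hβ d) (norm_nonneg d)
  rw [inner_sub_left] at h3 h4
  rw [cubicModel, ← hd] at h1
  nlinarith

/-- Size of the composite gradient after one inexact step. -/
lemma IsInexactStep.norm_gradient_le (hstep : IsInexactStep f ψ g B σ x xp sp) (hB : B.IsSymm)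
    (hσ : 0 ≤ σ) (hf : ContDiff ℝ 2 f) (A1 : HessianLipschitz f L)
    (hβ : ∀ v, ‖Matrix.toEuclideanCLM (𝕜 := ℝ) B v - hessian f x v‖ ≤ β * ‖v‖)
    (hδ : ‖gradient f x - g‖ ≤ δ) :
    ‖gradient f xp + sp‖ ≤ (L / 2 + 3 * σ / 4) * ‖xp - x‖ ^ 2 + δ + β * ‖xp - x‖ := by
  have h1 := hstep.stationary
  rw [gradient_cubicModel f g hB] at h1
  have h2 := norm_gradient_taylor_le hf A1 x (xp - x)
  rw [add_sub_cancel] at h2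
  set d := xp - x with hd
  have h3 : ‖(σ / 2 * ‖d‖) • d‖ = σ / 2 * ‖d‖ ^ 2 := by
    rw [norm_smul, Real.norm_eq_abs, abs_of_nonneg (by positivity)]; ring
  -- The coefficient `3 σ / 4` is `σ / 4` from inexact stationarity plus `σ / 2` from the gradient
  -- of the cubic term.
  have e : gradient f xp + sp
      = (g + Matrix.toEuclideanCLM (𝕜 := ℝ) B d + (σ / 2 * ‖d‖) • d + sp)
        + (gradient f xp - gradient f x - hessian f x d) + (gradient f x - g)
        - (Matrix.toEuclideanCLM (𝕜 := ℝ) B d - hessian f x d) - (σ / 2 * ‖d‖) • d := by abel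
  rw [e]
  refine (norm_sub_le _ _).trans ?_
  rw [h3]
  have h4 := norm_sub_le ((g + Matrix.toEuclideanCLM (𝕜 := ℝ) B d + (σ / 2 * ‖d‖) • d + sp)
        + (gradient f xp - gradient f x - hessian f x d) + (gradient f x - g))
        (Matrix.toEuclideanCLM (𝕜 := ℝ) B d - hessian f x d)
  have h5 := norm_add₃_le (a := g + Matrix.toEuclideanCLM (𝕜 := ℝ) B d + (σ / 2 * ‖d‖) • d + sp)
        (b := gradient f xp - gradient f x - hessian f x d) (c := gradient f x - g)
  have h6 := hβ d
  linarith

/-- Length of one inexact step at a point where the Hessian is bounded below. -/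
lemma IsInexactStep.norm_step_le (hstep : IsInexactStep f ψ g B σ x xp sp) (hB : B.IsSymm)
    (hσ : 0 ≤ σ) (hψ : IsProperClosedConvex ψ) {μ : ℝ}
    (hμ : ∀ v : E n, μ * ‖v‖ ^ 2 ≤ inner ℝ (hessian f x v) v)
    (hs : s ∈ subdifferential ψ x)
    (hβ : ∀ v, ‖Matrix.toEuclideanCLM (𝕜 := ℝ) B v - hessian f x v‖ ≤ β * ‖v‖)
    (hδ : ‖gradient f x - g‖ ≤ δ) :
    (μ - β) * ‖xp - x‖ ≤ ‖gradient f x + s‖ + δ := by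
  have h1 := hstep.stationary
  rw [gradient_cubicModel f g hB] at h1
  have hmono := subdifferential_monotone hψ hs hstep.mem_subdifferential
  set d := xp - x with hd
  rcases (norm_nonneg d).eq_or_lt with h0 | hpos
  · rw [← h0, mul_zero]
    exact add_nonneg (norm_nonneg _) ((norm_nonneg _).trans hδ)
  -- Pairing the residual with `d` lets `hmono` replace `sp` by `s`. The cubic term contributes `σ /
  -- 2 * ‖d‖ ^ 3` and the residual at most half of that, so both can be dropped.
  have h2 := (real_inner_le_norm _ d).trans (mul_le_mul_of_nonneg_right h1 (norm_nonneg d))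
  have h3 := (real_inner_le_norm (gradient f x - g) d).trans
    (mul_le_mul_of_nonneg_right hδ (norm_nonneg d))
  have h4 := (abs_le.1 (abs_real_inner_le_norm
    (Matrix.toEuclideanCLM (𝕜 := ℝ) B d - hessian f x d) d)).1
  have h5 := mul_le_mul_of_nonneg_right (hβ d) (norm_nonneg d)
  have h6 := (abs_le.1 (abs_real_inner_le_norm (gradient f x + s) d)).1
  have h7 := hμ d
  simp only [inner_sub_left, inner_add_left, real_inner_smul_left,
    real_inner_self_eq_norm_sq] at h2 h3 h4 h6 hmono
  have h8 : 0 ≤ σ * ‖d‖ ^ 3 := by positivity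
  have h9 : (μ - β) * ‖d‖ * ‖d‖ ≤ (‖gradient f x + s‖ + δ) * ‖d‖ := by nlinarith
  exact le_of_mul_le_mul_right h9 hpos

end Step

/-! ### Parameters of the method -/

lemma rpow_natCast_inv_pow {a : ℝ} (ha : 0 ≤ a) (e : ℝ) (k : ℕ) :
    (a ^ e) ^ k = a ^ (e * k) := by rw [Real.rpow_mul ha, Real.rpow_natCast]

lemma regParam_bounds {m : ℕ} {τ : ℝ} (hτ : 0 ≤ τ) (l : ℕ) :
    13 * (2 ^ l * τ) * m ≤ regParam m τ l ∧ regParam m τ l ≤ 14.1 * (2 ^ l * τ) * m := by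
  have hq := rpow_natCast_inv_pow (a := 2 / 3) (by norm_num) (1 / 3) 3
  have hq0 : (0 : ℝ) ≤ (2 / 3 : ℝ) ^ (1 / 3 : ℝ) := by positivity
  norm_num at hq
  rw [regParam]
  norm_num at hq0 ⊢
  set q := (2 / 3 : ℝ) ^ (1 / 3 : ℝ)
  have h1 : 13 / 16 ≤ q := le_of_pow_le_pow_left₀ (n := 3) (by norm_num) hq0 (by rw [hq]; norm_num)
  have h2 : q ≤ 141 / 160 :=
    le_of_pow_le_pow_left₀ (n := 3) (by norm_num) (by norm_num) (by rw [hq]; norm_num)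
  have hT : 0 ≤ 2 ^ l * τ * m := by positivity
  constructor <;> nlinarith

/-- A call may succeed with `2 ^ l * τ < L`. The local analysis still needs `τ` to dominate a
fraction of `L`, and the lower bound on `τ₀` provides it: `cgConst ^ 2 = 1 / (16 * 6 ^ (1 / 3))`. -/
lemma le_mul_of_cgConst {L τ : ℝ} (hL : 0 ≤ L) (h : 2 * cgConst ^ 2 * L / 3 ≤ τ) :
    L ≤ 45 * τ := by
  have hc : 1 / 30 ≤ cgConst ^ 2 := by
    have h1 := rpow_natCast_inv_pow (a := 2 / 3) (by norm_num) (1 / 6) 6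
    have h2 := rpow_natCast_inv_pow (a := 3) (by norm_num) (1 / 3) 6
    have h3 : (0 : ℝ) < (2 / 3 : ℝ) ^ (1 / 6 : ℝ) := by positivity
    have h4 : (0 : ℝ) < (3 : ℝ) ^ (1 / 3 : ℝ) := by positivity
    norm_num at h1 h2
    rw [cgConst]
    norm_num at h3 h4 ⊢
    set a := (3 : ℝ) ^ (1 / 3 : ℝ)
    set b := (2 / 3 : ℝ) ^ (1 / 6 : ℝ)
    have h5 : (a * b) ^ 2 ≤ 30 / 16 := by
      refine le_of_pow_le_pow_left₀ (n := 3) (by norm_num) (by norm_num) ?_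
      rw [← pow_mul, mul_pow, h1, h2]
      norm_num
    have h6 : (b⁻¹ * (1 / 4 * a⁻¹)) ^ 2 = 1 / (16 * (a * b) ^ 2) := by field_simp; norm_num
    rw [h6]
    exact one_div_le_one_div_of_le (by positivity) (by linarith)
  nlinarith

/-- The `√n` in the denominator of the squared step cancels the dimension factor, and `3 ^ (2 / 3) ≥
2` turns `6` into `12`. -/
lemma gradient_error_le {n m : ℕ} {L ε σ : ℝ} (hn : 0 < n) (hL : 0 ≤ L) (hε : 0 ≤ ε)
    (hσ : 0 < σ) :
    √n * (L / 6 * gradStep n m ε σ ^ 2) ≤ L * m * ε / (12 * σ) := by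
  have hn' : (0 : ℝ) < n := by exact_mod_cast hn
  have h2 := rpow_natCast_inv_pow (a := 3) (by norm_num) (1 / 3) 6
  have h4 : (0 : ℝ) < (3 : ℝ) ^ (1 / 3 : ℝ) := by positivity
  norm_num at h2
  rw [gradStep, ← Real.sqrt_eq_rpow, mul_pow, ← Real.sqrt_eq_rpow,
    Real.sq_sqrt (by positivity)]
  set a := (3 : ℝ) ^ (1 / 3 : ℝ)
  have h5 : 2 ≤ a ^ 2 :=
    le_of_pow_le_pow_left₀ (n := 3) (by norm_num) (by positivity)
      (by rw [← pow_mul, h2]; norm_num)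
  have hs : 0 < √(n : ℝ) := Real.sqrt_pos.2 hn'
  calc √n * (L / 6 * ((1 / a) ^ 2 * (ε * m / (σ * √n)))) = L * m * ε / (6 * a ^ 2 * σ) := by
        field_simp
    _ ≤ _ := by
        refine div_le_div_of_nonneg_left (by positivity) (by positivity) ?_
        nlinarith

lemma hessStep_pos {n m : ℕ} {ε τ : ℝ} (hn : 0 < n) (hm : 0 < m) (hε : 0 < ε) (hτ : 0 < τ)
    (l : ℕ) : 0 < hessStep n m ε τ l := by
  have hn' : (0 : ℝ) < n := by exact_mod_cast hn
  have hm' : (0 : ℝ) < m := by exact_mod_cast hm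
  have : 0 < regParam m τ l := by rw [regParam]; positivity
  rw [hessStep]
  positivity

/-- Cubing both sides removes the fractional exponents and cancels `n`. The constant left is `3 ^ 8
/ (2 ^ 28 * 192 ^ 2) = 729 / 2 ^ 40`, below `1000 ^ (-3)`. -/
lemma hessian_error_le {n m : ℕ} {ε τ : ℝ} (hn : 0 < n) (hm : 0 < m) (hε : 0 < ε) (hτ : 0 < τ)
    (l : ℕ) :
    (n * hessStep n m ε τ l) ^ 2 ≤ regParam m τ l * ε / (1000 * (2 ^ l * τ) ^ 2) := by
  have hn' : (0 : ℝ) < n := by exact_mod_cast hn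
  have hm' : (0 : ℝ) < m := by exact_mod_cast hm
  have hσ : 0 < regParam m τ l := by rw [regParam]; positivity
  have hpos := hessStep_pos hn hm hε hτ l
  have h1 : hessStep n m ε τ l ^ 6 = ((3 ^ 4 * (regParam m τ l) ^ (3 / 2 : ℝ) * ε ^ (3 / 2 : ℝ)) /
    (2 ^ 14 * 192 * (n : ℝ) ^ 3 * (2 ^ l * τ) ^ 3)) ^ 2 := by
    rw [hessStep, rpow_natCast_inv_pow (by positivity), ← Real.rpow_natCast _ 2]
    norm_num
  have h2 : ∀ a : ℝ, 0 ≤ a → (a ^ (3 / 2 : ℝ)) ^ 2 = a ^ 3 := fun a ha => by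
    rw [rpow_natCast_inv_pow ha, ← Real.rpow_natCast _ 3]; norm_num
  refine le_of_pow_le_pow_left₀ (n := 3) (by norm_num) (by positivity) ?_
  rw [← pow_mul, mul_pow, h1, div_pow, mul_pow, mul_pow, h2 _ hσ.le, h2 _ hε.le]
  set T := 2 ^ l * τ
  have hT : 0 < T := by positivity
  calc _ = (729 / 2 ^ 40) * ((regParam m τ l * ε) ^ 3 / T ^ 6) := by field_simp; ring
    _ ≤ (1 / 1000 ^ 3) * ((regParam m τ l * ε) ^ 3 / T ^ 6) :=
        mul_le_mul_of_nonneg_right (by norm_num) (by positivity)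
    _ = _ := by field_simp


/-! ### Real inequalities behind the adaptive search and the local convergence -/

/-- The prefix sum dominates the distance to the point where the Hessian was formed. AM-GM on each
pair, extended to all `N ^ 2` pairs, leaves a factor `N ≤ m`, which the `m` in `σ` later cancels. -/
lemma sum_prefix_mul_le {s : ℕ → ℝ} (hs : ∀ t, 0 ≤ s t) (N : ℕ) :
    ∑ t ∈ Finset.range N, (∑ i ∈ Finset.range t, s i) * s t
      ≤ N * ((2 * ∑ t ∈ Finset.range N, s t ^ 3 + N) / 3) := by
  have amgm : ∀ a b : ℝ, 0 ≤ a → 0 ≤ b → a * b ≤ (a ^ 3 + b ^ 3 + 1) / 3 := fun a b ha hb => by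
    nlinarith [mul_nonneg (add_nonneg (add_nonneg ha hb) zero_le_one) (sq_nonneg (a - b)),
      mul_nonneg (add_nonneg (add_nonneg ha hb) zero_le_one) (sq_nonneg (a - 1)),
      mul_nonneg (add_nonneg (add_nonneg ha hb) zero_le_one) (sq_nonneg (b - 1))]
  calc _ ≤ ∑ t ∈ Finset.range N, ∑ i ∈ Finset.range N, (s i ^ 3 + s t ^ 3 + 1) / 3 := by
        refine Finset.sum_le_sum fun t ht => ?_
        rw [Finset.sum_mul]
        refine (Finset.sum_le_sum fun i _ => amgm _ _ (hs i) (hs t)).trans ?_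
        refine Finset.sum_le_sum_of_subset_of_nonneg
          (Finset.range_mono (Finset.mem_range.1 ht).le) fun i _ _ => ?_
        have := pow_nonneg (hs i) 3
        have := pow_nonneg (hs t) 3
        positivity
    _ = _ := by
        simp only [← Finset.sum_div, Finset.sum_add_distrib, Finset.sum_const, Finset.card_range,
          nsmul_eq_mul, ← Finset.mul_sum]
        ring

lemma sum_prefix_mul_sq_le {s : ℕ → ℝ} (hs : ∀ t, 0 ≤ s t) (N : ℕ) :
    ∑ t ∈ Finset.range N, (∑ i ∈ Finset.range t, s i) * s t ^ 2
      ≤ N * ∑ t ∈ Finset.range N, s t ^ 3 := by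
  have amgm : ∀ a b : ℝ, 0 ≤ a → 0 ≤ b → a * b ^ 2 ≤ (a ^ 3 + 2 * b ^ 3) / 3 := fun a b ha hb => by
    nlinarith [mul_nonneg (add_nonneg ha (add_nonneg hb hb)) (sq_nonneg (a - b))]
  calc _ ≤ ∑ t ∈ Finset.range N, ∑ i ∈ Finset.range N, (s i ^ 3 + 2 * s t ^ 3) / 3 := by
        refine Finset.sum_le_sum fun t ht => ?_
        rw [Finset.sum_mul]
        refine (Finset.sum_le_sum fun i _ => amgm _ _ (hs i) (hs t)).trans ?_
        refine Finset.sum_le_sum_of_subset_of_nonneg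
          (Finset.range_mono (Finset.mem_range.1 ht).le) fun i _ _ => ?_
        have := pow_nonneg (hs i) 3
        have := pow_nonneg (hs t) 3
        positivity
    _ = _ := by
        simp only [← Finset.sum_div, Finset.sum_add_distrib, Finset.sum_const, Finset.card_range,
          nsmul_eq_mul, ← Finset.mul_sum]
        ring

/-- Total decrease along a sequence of steps, in normalized units. -/
lemma le_sum_decrease {s : ℕ → ℝ} (hs : ∀ t, 0 ≤ s t) {N m : ℕ} (hNm : N ≤ m) (hm : 0 < m)
    (h : ∀ t < N, 1 ≤ 0.8 * s t ^ 2 + 0.01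
      + 0.04 * s t + 1 / (13 * m) * ((∑ i ∈ Finset.range t, s i) * s t)) :
    (N : ℝ) / 384 ≤ ∑ t ∈ Finset.range N, (0.15 * s t ^ 3 - 0.01 * s t - 0.02 * s t ^ 2
      - 1 / (26 * m) * ((∑ i ∈ Finset.range t, s i) * s t ^ 2)) := by
  have hm' : (0 : ℝ) < m := by exact_mod_cast hm
  have hN : (N : ℝ) ≤ m := by exact_mod_cast hNm
  have hN0 : (0 : ℝ) ≤ N := Nat.cast_nonneg N
  set C := ∑ t ∈ Finset.range N, s t ^ 3 with hC
  have hC0 : 0 ≤ C := Finset.sum_nonneg fun t _ => pow_nonneg (hs t) 3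
  have b1 : ∑ t ∈ Finset.range N, s t ≤ (C + 2 * N) / 3 := by
    calc _ ≤ ∑ t ∈ Finset.range N, (s t ^ 3 + 2) / 3 := Finset.sum_le_sum fun t _ => by
          nlinarith [hs t, mul_nonneg (add_nonneg (hs t) (zero_le_two)) (sq_nonneg (s t - 1))]
      _ = _ := by
          simp only [← Finset.sum_div, Finset.sum_add_distrib, Finset.sum_const,
            Finset.card_range, nsmul_eq_mul]
          ring
  have b2 : ∑ t ∈ Finset.range N, s t ^ 2 ≤ (2 * C + N) / 3 := by
    calc _ ≤ ∑ t ∈ Finset.range N, (2 * s t ^ 3 + 1) / 3 := Finset.sum_le_sum fun t _ => by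
          nlinarith [hs t, mul_nonneg (hs t) (sq_nonneg (s t - 1)), sq_nonneg (s t - 1)]
      _ = _ := by
          simp only [← Finset.sum_div, Finset.sum_add_distrib, Finset.sum_const,
            Finset.card_range, nsmul_eq_mul, ← Finset.mul_sum]
          ring
  have b3 := sum_prefix_mul_le hs N
  have b4 := sum_prefix_mul_sq_le hs N
  rw [← hC] at b3 b4
  set P := ∑ t ∈ Finset.range N, (∑ i ∈ Finset.range t, s i) * s t with hP
  set R := ∑ t ∈ Finset.range N, (∑ i ∈ Finset.range t, s i) * s t ^ 2 with hR
  have b3' : 1 / (13 * (m : ℝ)) * P ≤ 1 / 13 * ((2 * C + N) / 3) := by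
    rw [one_div_mul_eq_div, div_le_iff₀ (by positivity)]
    nlinarith [mul_le_mul_of_nonneg_right hN (by positivity : 0 ≤ (2 * C + N) / 3)]
  have b4' : 1 / (26 * (m : ℝ)) * R ≤ 1 / 26 * C := by
    rw [one_div_mul_eq_div, div_le_iff₀ (by positivity)]
    nlinarith [mul_le_mul_of_nonneg_right hN hC0]
  -- Inserting the AM-GM bounds into the summed hypothesis forces `C ≥ 1.1 N`. The decrease is then
  -- at least about `0.09 N`, far above `N / 384`.
  have total := Finset.sum_le_sum fun t ht => h t (Finset.mem_range.1 ht)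
  simp only [Finset.sum_add_distrib, Finset.sum_sub_distrib, ← Finset.mul_sum, Finset.sum_const,
    Finset.card_range, nsmul_eq_mul] at total ⊢
  rw [← hP] at total
  rw [← hC, ← hR]
  norm_num at total ⊢
  rw [one_div, mul_inv] at b3' b4'
  linarith

/-- Total decrease along a sequence of steps whose end points have composite gradients of norm
above `ε`. -/
lemma le_sum_decrease_of_large_gradients {r ρ : ℕ → ℝ} {ε σ L δ δB : ℝ} {N m : ℕ}
    (hr : ∀ t, 0 ≤ r t) (hNm : N ≤ m) (hm : 0 < m) (hε : 0 < ε) (hσ : 0 < σ) (hL : 0 ≤ L)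
    (hLσ : 13 * L * m ≤ σ) (hδ : δ ≤ 0.01 * ε) (hδB : δB ^ 2 ≤ σ * ε / 1000)
    (hρ : ∀ t < N, ρ t ≤ ∑ i ∈ Finset.range t, r i)
    (h : ∀ t < N, ε ≤ (L / 2 + 3 * σ / 4) * r t ^ 2 + δ + (δB + L * ρ t) * r t) :
    ε ^ (3 / 2 : ℝ) / (384 * σ ^ (1 / 2 : ℝ)) * (N : ℝ) ≤ ∑ t ∈ Finset.range N,
      ((σ - L) / 6 * r t ^ 3 - δ * r t - (δB + L * ρ t) / 2 * r t ^ 2) := by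
  have hm' : (1 : ℝ) ≤ m := by exact_mod_cast hm
  -- `w = √(ε / σ)` is the natural step length: in units of `w`, the gradient threshold is `σ w ^ 2`
  -- and the required decrease per step is `σ w ^ 3 / 384`.
  obtain ⟨w, hw, rfl⟩ : ∃ w : ℝ, 0 < w ∧ ε = σ * w ^ 2 :=
    ⟨√(ε / σ), by positivity, by rw [Real.sq_sqrt (by positivity)]; field_simp⟩
  have hL' : 13 * L ≤ σ := by nlinarith
  have hδB' : δB ≤ 0.04 * (σ * w) := by
    refine le_of_sq_le_sq (hδB.trans ?_) (by positivity)
    nlinarith [sq_nonneg (σ * w)]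
  have hσw : (σ * w ^ 2) ^ (3 / 2 : ℝ) / (384 * σ ^ (1 / 2 : ℝ)) = σ * w ^ 3 / 384 := by
    have e1 : (w ^ 2) ^ (3 / 2 : ℝ) = w ^ 3 := by
      rw [← Real.rpow_natCast w 2, ← Real.rpow_mul hw.le, ← Real.rpow_natCast w 3]; norm_num
    have e2 : σ ^ (3 / 2 : ℝ) = σ * σ ^ (1 / 2 : ℝ) := by
      rw [← Real.rpow_one_add' hσ.le (by norm_num)]; norm_num
    rw [Real.mul_rpow hσ.le (by positivity), e1, e2]
    field_simp
  have hLm : L ≤ σ * (1 / (13 * m)) := by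
    rw [mul_one_div, le_div_iff₀ (by positivity)]; linarith
  set s : ℕ → ℝ := fun t => r t / w with hs
  have hrs : ∀ t, r t = w * s t := fun t => by simp only [hs]; field_simp
  have hs0 : ∀ t, 0 ≤ s t := fun t => div_nonneg (hr t) hw.le
  have hρs : ∀ t < N, L * ρ t ≤ σ * w * (1 / (13 * m) * ∑ i ∈ Finset.range t, s i) := by
    intro t ht
    have h1 := hρ t ht
    simp only [hrs, ← Finset.mul_sum] at h1
    have h2 : 0 ≤ ∑ i ∈ Finset.range t, s i := Finset.sum_nonneg fun i _ => hs0 i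
    have h3 := mul_le_mul_of_nonneg_left h1 hL
    have h4 := mul_le_mul_of_nonneg_right hLm (mul_nonneg hw.le h2)
    linarith
  have key := le_sum_decrease hs0 hNm hm (fun t ht => by
    have h1 := h t ht
    have h2 := mul_le_mul_of_nonneg_right (add_le_add hδB' (hρs t ht)) (hr t)
    have h3 : (L / 2 + 3 * σ / 4) * r t ^ 2 ≤ 0.8 * σ * r t ^ 2 :=
      mul_le_mul_of_nonneg_right (by linarith) (sq_nonneg _)
    rw [hrs] at h1 h2 h3
    refine le_of_mul_le_mul_left ?_ (by positivity : 0 < σ * w ^ 2)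
    linarith)
  rw [hσw]
  calc σ * w ^ 3 / 384 * N = σ * w ^ 3 * (N / 384) := by ring
    _ ≤ _ := mul_le_mul_of_nonneg_left key (by positivity)
    _ ≤ _ := by
      rw [Finset.mul_sum]
      refine Finset.sum_le_sum fun t ht => ?_
      have h2 := mul_le_mul_of_nonneg_right
        (add_le_add hδB' (hρs t (Finset.mem_range.1 ht))) (sq_nonneg (r t))
      have h3 : 0.15 * σ * r t ^ 3 ≤ (σ - L) / 6 * r t ^ 3 :=
        mul_le_mul_of_nonneg_right (by linarith) (pow_nonneg (hr t) 3)
      have h4 := mul_le_mul_of_nonneg_right hδ (hr t)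
      rw [show (1 : ℝ) / (26 * m) = 1 / (13 * m) / 2 by field_simp; norm_num]
      rw [hrs] at h2 h3 h4 ⊢
      linarith

/-- One step of the local phase: the length of the step and the new norm `b` of the composite
gradient, in terms of the present norm `a` and the norm `a₀` at the start of the call. -/
lemma local_step {a b a₀ r ρ μ κ S σ L δ δB ε : ℝ} (hμ : 0 < μ)
    (hr : 0 ≤ r) (hρ : 0 ≤ ρ) (hε : 0 < ε) (ha : ε ≤ a) (hb : ε ≤ b) (hL : 0 ≤ L) (hκ : 0 < κ)
    (hσS : σ ≤ S) (hLS : 27 * L ≤ S) (hδ : δ ≤ 0.3 * ε) (hδB : δB ^ 2 ≤ ε * S / 40)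
    (ha₀ : a₀ ≤ κ / 2) (hκS : 12 * S * κ ≤ μ ^ 2)
    (hinv : μ * ρ + 4 * a ≤ 4 * a₀)
    (hlen : (μ - (δB + L * ρ)) * r ≤ a + δ)
    (hgrad : b ≤ (L / 2 + 3 * σ / 4) * r ^ 2 + δ + (δB + L * ρ) * r) :
    μ * r ≤ 2 * a ∧ κ * b ≤ a * a₀ := by
  have haa₀ : a ≤ a₀ := by nlinarith [mul_nonneg hμ.le hρ]
  have ha_pos : 0 < a := hε.trans_le ha
  have hS : 0 ≤ S := by linarith
  -- The invariant and `a₀ ≤ κ / 2` give `μ * ρ ≤ 2 * κ`; with `27 L ≤ S` and `12 S κ ≤ μ ^ 2` the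
  -- drift is negligible beside `μ`.
  have h1 : L * ρ ≤ μ / 100 := by
    refine le_of_mul_le_mul_left ?_ hμ
    have : L * (μ * ρ) ≤ L * (2 * κ) := mul_le_mul_of_nonneg_left (by linarith) hL
    have : 27 * L * κ ≤ S * κ := mul_le_mul_of_nonneg_right hLS hκ.le
    nlinarith
  have h2 : δB ≤ μ / 30 := by
    refine le_of_sq_le_sq (hδB.trans ?_) (by positivity)
    have : ε * S ≤ κ / 2 * S := mul_le_mul_of_nonneg_right (by linarith) hS
    nlinarith
  have hlen' : μ * r ≤ 2 * a := by
    have : (δB + L * ρ) * r ≤ (μ / 30 + μ / 100) * r :=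
      mul_le_mul_of_nonneg_right (add_le_add h2 h1) hr
    nlinarith
  refine ⟨hlen', ?_⟩
  -- Since `ε ≤ b`, this is AM-GM with `4 * 0.2 / 32 = 1 / 40`.
  have h3 : δB * r ≤ 0.2 * b + S / 32 * r ^ 2 := by
    rcases hS.eq_or_lt with hS0 | hS0
    · have : δB = 0 := by
        rw [← hS0] at hδB
        nlinarith [sq_nonneg δB]
      rw [this, ← hS0]
      linarith
    · have h4 : δB ^ 2 ≤ b * S / 40 := hδB.trans (by nlinarith)
      have h5 : δB ^ 2 * r ^ 2 ≤ b * S / 40 * r ^ 2 :=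
        mul_le_mul_of_nonneg_right h4 (sq_nonneg r)
      have hb0 : 0 < b := hε.trans_le hb
      refine le_of_sq_le_sq ?_ (by positivity)
      nlinarith [sq_nonneg (0.2 * b - S / 32 * r ^ 2)]
  have h4 : (L / 2 + 3 * σ / 4) * r ^ 2 ≤ 0.77 * S * r ^ 2 :=
    mul_le_mul_of_nonneg_right (by linarith) (sq_nonneg r)
  -- From `b` are subtracted `0.3 b`, which covers `δ`, and `0.2 b` from `h3`.
  have h5 : 0.5 * b ≤ 0.81 * S * r ^ 2 + L * ρ * r := by nlinarith
  have h6 : (μ * r) ^ 2 ≤ 4 * (a * a₀) := by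
    have : (μ * r) ^ 2 ≤ (2 * a) ^ 2 := pow_le_pow_left₀ (by positivity) hlen' 2
    nlinarith
  have h7 : (μ * ρ) * (μ * r) ≤ 4 * a₀ * (2 * a) :=
    mul_le_mul (by linarith) hlen' (by positivity) (by linarith)
  -- The factor obtained is `6.48 S + 16 L`, and `27 L ≤ S` keeps it below `12 S`.
  have h8 : μ ^ 2 * b ≤ 12 * S * (a * a₀) := by
    have i1 := mul_le_mul_of_nonneg_left h6 hS
    have i2 := mul_le_mul_of_nonneg_left h7 hL
    have i3 := mul_le_mul_of_nonneg_left h5 (sq_nonneg μ)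
    have i4 : 27 * L * (a * a₀) ≤ S * (a * a₀) :=
      mul_le_mul_of_nonneg_right hLS (mul_nonneg ha_pos.le (ha_pos.le.trans haa₀))
    have i5 := mul_nonneg hS (mul_nonneg ha_pos.le (ha_pos.le.trans haa₀))
    linarith
  have h9 : μ ^ 2 * (κ * b) ≤ μ ^ 2 * (a * a₀) := by
    have i1 := mul_le_mul_of_nonneg_left h8 hκ.le
    have i2 := mul_le_mul_of_nonneg_right hκS
      (mul_nonneg ha_pos.le (ha_pos.le.trans haa₀))
    linarith
  exact le_of_mul_le_mul_left h9 (by positivity)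


/-! ### One call of `ZeroOrderCubicSteps` -/

section Call

variable {n : ℕ} {f : E n → ℝ} {ψ : E n → EReal} {L : ℝ} {x s : E n} {m l : ℕ} {ε τ : ℝ}
  {y p : ℕ → E n}

lemma IterateComputed.of_le {σ : ℝ} {t j : ℕ} (h : IterateComputed f ψ σ m ε y t) (hj : j ≤ t) :
    IterateComputed f ψ σ m ε y j :=
  ⟨hj.trans h.1, fun i h1 h2 => h.2 i h1 (h2.trans_le hj)⟩

lemma Succeeds.iterateComputed {σ : ℝ} {t : ℕ} (h : Succeeds f ψ σ m ε y) (ht : t ≤ m) :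
    IterateComputed f ψ σ m ε y t :=
  ⟨ht, fun j h1 h2 => h j h1 (h2.le.trans ht)⟩

lemma IsZeroOrderCubicSteps.mem_subdifferential {B : Matrix (Fin n) (Fin n) ℝ} {σ : ℝ}
    (hcall : IsZeroOrderCubicSteps f ψ x s B σ m ε y p) (hs : s ∈ subdifferential ψ x)
    {t : ℕ} (ht : IterateComputed f ψ σ m ε y t) : p t ∈ subdifferential ψ (y t) := by
  cases t with
  | zero => rwa [hcall.y_zero, hcall.p_zero]
  | succ t => exact (hcall.step t ht).mem_subdifferential

lemma hessian_model_error_le (hf : ContDiff ℝ 2 f) (A1 : HessianLipschitz f L) (hL : 0 ≤ L)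
    {h : ℝ} (hh : 0 < h) (x z v : E n) :
    ‖Matrix.toEuclideanCLM (𝕜 := ℝ) (fdHessian f h x) v - hessian f z v‖
      ≤ (L * (n * h) + L * ‖z - x‖) * ‖v‖ := by
  have h1 := norm_fdHessian_sub_hessian_le hf A1 hL hh x v
  have h2 := A1.norm_apply_sub_le z x v
  rw [norm_sub_rev x z] at h2
  have h3 := norm_add_le (Matrix.toEuclideanCLM (𝕜 := ℝ) (fdHessian f h x) v - hessian f x v)
    (hessian f x v - hessian f z v)
  rw [sub_add_sub_cancel] at h3
  linarith

lemma gradStep_pos {σ : ℝ} (hn : 0 < n) (hm : 0 < m) (hε : 0 < ε) (hσ : 0 < σ) :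
    0 < gradStep n m ε σ := by
  have hn' : (0 : ℝ) < n := by exact_mod_cast hn
  have hm' : (0 : ℝ) < m := by exact_mod_cast hm
  rw [gradStep]
  positivity

lemma fdGradient_error_le (hf : ContDiff ℝ 2 f) (A1 : HessianLipschitz f L) (hL : 0 ≤ L)
    {σ : ℝ} (hn : 0 < n) (hm : 0 < m) (hε : 0 < ε) (hσ : 0 < σ) (z : E n) :
    ‖gradient f z - fdGradient f (gradStep n m ε σ) z‖ ≤ L * m * ε / (12 * σ) :=
  (norm_gradient_sub_fdGradient_le hf A1 hL (gradStep_pos hn hm hε hσ) z).trans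
    (gradient_error_le hn hL hε.le hσ)

lemma norm_sub_zero_le_sum (y : ℕ → E n) (t : ℕ) :
    ‖y t - y 0‖ ≤ ∑ i ∈ Finset.range t, ‖y (i + 1) - y i‖ := by
  rw [← Finset.sum_range_sub]
  exact norm_sum_le _ _

lemma regParam_pos (hm : 0 < m) (hτ : 0 < τ) : 0 < regParam m τ l := by
  have hm' : (0 : ℝ) < m := by exact_mod_cast hm
  rw [regParam]
  positivity

/-- A call with a large enough regularization parameter either computes an iterate whose composite
gradient has norm at most `ε`, or succeeds. -/
lemma IsZeroOrderCubicSteps.succeeds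
    (hcall : IsZeroOrderCubicSteps f ψ x s (fdHessian f (hessStep n m ε τ l) x)
      (regParam m τ l) m ε y p)
    (hs : s ∈ subdifferential ψ x) (hψ : IsProperClosedConvex ψ) (hf : ContDiff ℝ 2 f)
    (A1 : HessianLipschitz f L) (hL : 0 ≤ L) (hn : 0 < n) (hm : 0 < m) (hε : 0 < ε)
    (hτ : 0 < τ) (hLτ : L ≤ 2 ^ l * τ)
    (hlarge : ∀ t, IterateComputed f ψ (regParam m τ l) m ε y t → ε < ‖gradient f (y t) + p t‖) :
    Succeeds f ψ (regParam m τ l) m ε y := by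
  have hm' : (0 : ℝ) < m := by exact_mod_cast hm
  have hσ := regParam_pos (l := l) hm hτ
  have hσlow := (regParam_bounds (m := m) hτ.le l).1
  have hhess := hessian_error_le hn hm hε hτ l
  have hhpos := hessStep_pos hn hm hε hτ l
  set σ := regParam m τ l
  set h := hessStep n m ε τ l
  set T := 2 ^ l * τ
  have hT : 0 < T := by positivity
  have hLm : 13 * L * m ≤ σ := by nlinarith
  have hB := fdHessian_isSymm f h x
  -- Strong induction: the earlier passed tests guarantee that all iterates up to `y j` are
  -- computed, so the estimates for the first `j` steps apply to the `j`-th test.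
  intro j
  induction j using Nat.strong_induction_on with
  | _ j ih =>
  intro _ hjm
  have hcomp : IterateComputed f ψ σ m ε y j :=
    ⟨hjm, fun i h1 h2 => ih i h2 h1 (h2.le.trans hjm)⟩
  have hmem : ∀ t ≤ j, y t ∈ effDomain ψ := fun t ht =>
    (hcall.mem_subdifferential hs (hcomp.of_le ht)).1
  refine passesTest_of_le hψ (hmem 0 (Nat.zero_le j)) (hmem j le_rfl) ?_
  have hβ : ∀ t, ∀ v, ‖Matrix.toEuclideanCLM (𝕜 := ℝ) (fdHessian f h x) v - hessian f (y t) v‖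
      ≤ (L * (n * h) + L * ‖y t - y 0‖) * ‖v‖ := fun t v => by
    rw [hcall.y_zero]
    exact hessian_model_error_le hf A1 hL hhpos x (y t) v
  have hδ := fun t => fdGradient_error_le hf A1 hL hn hm hε hσ (y t)
  refine (le_sum_decrease_of_large_gradients (r := fun t => ‖y (t + 1) - y t‖)
    (ρ := fun t => ‖y t - y 0‖) (L := L) (δ := L * m * ε / (12 * σ)) (δB := L * (n * h))
    (fun t => norm_nonneg _) hjm hm hε hσ hL hLm ?_ ?_
    (fun t _ => norm_sub_zero_le_sum y t) (fun t ht => ?_)).trans ?_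
  · rw [div_le_iff₀ (by positivity)]
    nlinarith
  · calc (L * (n * h)) ^ 2 = L ^ 2 * (n * h) ^ 2 := by ring
      _ ≤ T ^ 2 * (σ * ε / (1000 * T ^ 2)) :=
          mul_le_mul (pow_le_pow_left₀ hL hLτ 2) hhess (by positivity) (by positivity)
      _ = σ * ε / 1000 := by field_simp
  · have hc := hcomp.of_le (Nat.succ_le_of_lt ht)
    exact (hlarge _ hc).le.trans
      ((hcall.step t hc).norm_gradient_le hB hσ.le hf A1 (hβ t) (hδ t))
  · rw [← Finset.sum_range_sub' (fun t => f (y t) + (ψ (y t)).toReal)]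
    refine Finset.sum_le_sum fun t ht => ?_
    have ht := Finset.mem_range.1 ht
    have hc := hcomp.of_le (Nat.succ_le_of_lt ht)
    have := (hcall.step t hc).objective_le hψ hf A1 (hmem t ht.le) (hβ t) (hδ t)
    linarith

/-- Local convergence in a successful call none of whose iterates has a composite gradient of norm
at most `ε`. -/
lemma IsZeroOrderCubicSteps.norm_gradient_last_le
    (hcall : IsZeroOrderCubicSteps f ψ x s (fdHessian f (hessStep n m ε τ l) x)
      (regParam m τ l) m ε y p)
    (hs : s ∈ subdifferential ψ x) (hψ : IsProperClosedConvex ψ) (hf : ContDiff ℝ 2 f)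
    (A1 : HessianLipschitz f L) (hL : 0 ≤ L) (hn : 0 < n) (hm : 0 < m) (hε : 0 < ε)
    (hτ : 0 < τ) {μ κ S : ℝ} (hμ : 0 < μ) (A2 : HessianBoundedBelow f (effDomain ψ) μ)
    (hκ : 0 < κ) (hκS : 12 * S * κ ≤ μ ^ 2) (hLS : 27 * (L * m) ≤ S) (hσS : regParam m τ l ≤ S)
    (hLτ : L ≤ 45 * (2 ^ l * τ)) (hstart : ‖gradient f x + s‖ ≤ κ / 2)
    (hsucc : Succeeds f ψ (regParam m τ l) m ε y)
    (hlarge : ∀ t ≤ m, ε < ‖gradient f (y t) + p t‖) :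
    κ ^ m * ‖gradient f (y m) + p m‖ ≤ ‖gradient f x + s‖ ^ (m + 1) := by
  have hm' : (1 : ℝ) ≤ m := by exact_mod_cast hm
  have hσ := regParam_pos (l := l) hm hτ
  obtain ⟨hσlow, hσup⟩ := regParam_bounds (m := m) hτ.le l
  have hhess := hessian_error_le hn hm hε hτ l
  have hhpos := hessStep_pos hn hm hε hτ l
  set σ := regParam m τ l
  set h := hessStep n m ε τ l
  set T := 2 ^ l * τ
  have hT : 0 < T := by positivity
  have hB := fdHessian_isSymm f h x
  have hLS' : 27 * L ≤ S := by nlinarith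
  have hδ : L * m * ε / (12 * σ) ≤ 0.3 * ε := by
    rw [div_le_iff₀ (by positivity)]
    have : L * m ≤ 45 * T * m := mul_le_mul_of_nonneg_right hLτ (by positivity)
    have : L * m ≤ 0.3 * (12 * σ) := by nlinarith
    nlinarith
  -- Only one factor `L` is traded for `45 T`; the other is kept for `27 (L m) ≤ S`. It suffices
  -- that `45 * 14.1 / 1000 = 0.6345 ≤ 27 / 40`.
  have hδB : (L * (n * h)) ^ 2 ≤ ε * S / 40 := by
    calc (L * (n * h)) ^ 2 = L ^ 2 * (n * h) ^ 2 := by ring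
      _ ≤ (L * (45 * T)) * (σ * ε / (1000 * T ^ 2)) :=
          mul_le_mul (by rw [sq]; exact mul_le_mul_of_nonneg_left hLτ hL) hhess
            (by positivity) (by positivity)
      _ ≤ (L * (45 * T)) * (14.1 * T * m * ε / (1000 * T ^ 2)) := by gcongr
      _ = 0.6345 * ε * (L * m) := by field_simp; ring
      _ ≤ _ := by nlinarith
  -- The first invariant survives a step because `μ` times the step length is at most `2 a` and the
  -- gradient norm at least halves, so `μ ρ` gains no more than `4 a` loses. It keeps the iterates
  -- near the start of the call.
  have key : ∀ t ≤ m, μ * ‖y t - y 0‖ + 4 * ‖gradient f (y t) + p t‖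
        ≤ 4 * ‖gradient f x + s‖ ∧
      κ ^ t * ‖gradient f (y t) + p t‖ ≤ ‖gradient f x + s‖ ^ (t + 1) := by
    intro t
    induction t with
    | zero => intro _; simp [hcall.y_zero, hcall.p_zero]
    | succ t ih =>
      intro ht
      obtain ⟨ih1, ih2⟩ := ih (Nat.le_of_succ_le ht)
      have hstep := hcall.step t (hsucc.iterateComputed ht)
      have hmem := hcall.mem_subdifferential hs (hsucc.iterateComputed (Nat.le_of_succ_le ht))
      have hβ : ∀ v, ‖Matrix.toEuclideanCLM (𝕜 := ℝ) (fdHessian f h x) v - hessian f (y t) v‖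
          ≤ (L * (n * h) + L * ‖y t - y 0‖) * ‖v‖ := fun v => by
        rw [hcall.y_zero]
        exact hessian_model_error_le hf A1 hL hhpos x (y t) v
      have hg := fdGradient_error_le hf A1 hL hn hm hε hσ (y t)
      obtain ⟨h1, h2⟩ := local_step hμ (norm_nonneg _) (norm_nonneg _) hε
        (hlarge t (Nat.le_of_succ_le ht)).le (hlarge (t + 1) ht).le hL hκ hσS hLS' hδ hδB hstart
        hκS ih1 (hstep.norm_step_le hB hσ.le hψ (A2 _ hmem.1) hmem hβ hg)
        (hstep.norm_gradient_le hB hσ.le hf A1 hβ hg)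
      have hpos : 0 < ‖gradient f (y t) + p t‖ := hε.trans (hlarge t (Nat.le_of_succ_le ht))
      constructor
      · have h3 := norm_add_le (y (t + 1) - y t) (y t - y 0)
        rw [sub_add_sub_cancel] at h3
        have h4 : 2 * ‖gradient f (y (t + 1)) + p (t + 1)‖ ≤ ‖gradient f (y t) + p t‖ := by
          refine le_of_mul_le_mul_left ?_ hκ
          nlinarith
        nlinarith [mul_le_mul_of_nonneg_left h3 hμ.le]
      · calc κ ^ (t + 1) * ‖gradient f (y (t + 1)) + p (t + 1)‖
            = κ ^ t * (κ * ‖gradient f (y (t + 1)) + p (t + 1)‖) := by ring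
          _ ≤ κ ^ t * (‖gradient f (y t) + p t‖ * ‖gradient f x + s‖) :=
              mul_le_mul_of_nonneg_left h2 (by positivity)
          _ = (κ ^ t * ‖gradient f (y t) + p t‖) * ‖gradient f x + s‖ := by ring
          _ ≤ ‖gradient f x + s‖ ^ (t + 1) * ‖gradient f x + s‖ :=
              mul_le_mul_of_nonneg_right ih2 (norm_nonneg _)
          _ = _ := by ring
  exact (key m le_rfl).2

end Call


/-! ### The outer iterations -/

section Outer

variable {n : ℕ} {f : E n → ℝ} {ψ : E n → EReal} {L μ τ₀ ε : ℝ} {m : ℕ} {x₀ s₀ : E n}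
  {r : Trace n}

/-- The quantity multiplied by `12` is the cap `S` on `σ` in a successful call. The first summand of
the bracket in `kappa` equals `6 S`; the other two only shrink `kappa`. -/
lemma kappa_bounds (hL : 0 ≤ L) (hμ : 0 < μ) (hτ₀ : 0 < τ₀) (hm : 0 < m) :
    0 < kappa μ L τ₀ m ∧
      12 * (32 * (2 / 3 : ℝ) ^ (1 / 3 : ℝ) * m * max τ₀ L) * kappa μ L τ₀ m ≤ μ ^ 2 := by
  have hm' : (0 : ℝ) < m := by exact_mod_cast hm
  have hmax : 0 < max τ₀ L := lt_max_of_lt_left hτ₀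
  have hq : (0 : ℝ) < (2 / 3 : ℝ) ^ (1 / 3 : ℝ) := by positivity
  rw [kappa]
  set q := (2 / 3 : ℝ) ^ (1 / 3 : ℝ)
  set K := 3 * 2 ^ 6 * q * m * max τ₀ L + 8 * L + cConst ^ 2 * L ^ 2 * m / τ₀ with hKdef
  have hK : 6 * (32 * q * m * max τ₀ L) ≤ K := by
    have : 0 ≤ 8 * L + cConst ^ 2 * L ^ 2 * m / τ₀ := by positivity
    rw [hKdef]
    linarith
  have hK0 : 0 < K := lt_of_lt_of_le (by positivity) hK
  refine ⟨by positivity, ?_⟩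
  calc _ = 6 * (32 * q * m * max τ₀ L) * μ ^ 2 * K⁻¹ := by ring
    _ ≤ K * μ ^ 2 * K⁻¹ := by gcongr
    _ = μ ^ 2 := by field_simp

lemma regParam_le (hτ₀ : 0 < τ₀) {τ : ℝ} {l : ℕ} (h : 2 ^ l * τ ≤ 2 * max τ₀ L) :
    regParam m τ l ≤ 32 * (2 / 3 : ℝ) ^ (1 / 3 : ℝ) * m * max τ₀ L := by
  have hmax : 0 < max τ₀ L := lt_max_of_lt_left hτ₀
  rw [regParam]
  calc _ ≤ 2 ^ 4 * (2 / 3 : ℝ) ^ (1 / 3 : ℝ) * (2 * max τ₀ L) * m := by gcongr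
    _ = _ := by ring

lemma lipschitz_le_regParam (hL : 0 ≤ L) :
    27 * (L * m) ≤ 32 * (2 / 3 : ℝ) ^ (1 / 3 : ℝ) * m * max τ₀ L := by
  have hq := rpow_natCast_inv_pow (a := 2 / 3) (by norm_num) (1 / 3) 3
  have hq0 : (0 : ℝ) ≤ (2 / 3 : ℝ) ^ (1 / 3 : ℝ) := by positivity
  norm_num at hq
  norm_num at hq0 ⊢
  set q := (2 / 3 : ℝ) ^ (1 / 3 : ℝ)
  have h1 : 27 / 32 ≤ q := le_of_pow_le_pow_left₀ (n := 3) (by norm_num) hq0 (by rw [hq]; norm_num)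
  calc 27 * (L * m) = 32 * (27 / 32) * m * L := by ring
    _ ≤ 32 * q * m * max τ₀ L := by
      gcongr
      exact le_max_right _ _

/-- As long as no iteration contains an iterate with small composite gradient, every adaptive
search ends and the composite gradients converge superlinearly. -/
lemma IsZeroOrderCNM.convergence_before_hit (hr : IsZeroOrderCNM f ψ x₀ s₀ τ₀ ε m r)
    (hf : ContDiff ℝ 2 f) (hψ : IsProperClosedConvex ψ)
    (hL : 0 ≤ L) (hμ : 0 < μ) (hτ₀ : 0 < τ₀) (hε : 0 < ε) (hm : 0 < m) (hn : 0 < n)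
    (A1 : HessianLipschitz f L) (A2 : HessianBoundedBelow f (effDomain ψ) μ)
    (hτ₀_big : 2 * cgConst ^ 2 * L / 3 ≤ τ₀)
    (hx₀ : InLocalRegion f ψ ε (kappa μ L τ₀ m) x₀ s₀) (k : ℕ)
    (hno : ∀ k' < k, ¬ r.HitsAt f ψ m ε k') :
    (∀ k' < k, ∃ l', r.CallSucceeds f ψ m ε k' l') ∧ τ₀ ≤ r.τ k ∧ r.τ k ≤ max τ₀ L ∧
      r.s k ∈ subdifferential ψ (r.x k) ∧ ε ≤ ‖gradient f (r.x k) + r.s k‖ ∧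
      ‖gradient f (r.x k) + r.s k‖ ≤ kappa μ L τ₀ m * (1 / 2) ^ (1 + m) ^ k := by
  obtain ⟨hκ, hκS⟩ := kappa_bounds hL hμ hτ₀ hm
  induction k with
  | zero =>
    refine ⟨by simp, hr.τ_zero.ge, hr.τ_zero.trans_le (le_max_left _ _), ?_, ?_, ?_⟩
    · rw [hr.x_zero, hr.s_zero]; exact hx₀.mem_subdifferential
    · rw [hr.x_zero, hr.s_zero]; exact hx₀.le_norm
    · rw [hr.x_zero, hr.s_zero, pow_zero, pow_one, mul_one_div]; exact hx₀.norm_le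
  | succ k ih =>
    obtain ⟨hprev, hτlow, hτup, hs, -, hG⟩ :=
      ih fun k' hk' => hno k' (hk'.trans (Nat.lt_succ_self k))
    have hτpos : 0 < r.τ k := hτ₀.trans_le hτlow
    have hnok := hno k (Nat.lt_succ_self k)
    have hlarge : ∀ l, r.CallExecuted f ψ m ε k l → ∀ t,
        IterateComputed f ψ (regParam m (r.τ k) l) m ε (r.y k l) t →
        ε < ‖gradient f (r.y k l t) + r.p k l t‖ := fun l hl t ht => by
      by_contra hcon
      exact hnok ⟨l, t, ⟨hl, ht⟩, not_lt.1 hcon⟩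
    have hsearch : ∀ l, r.CallExecuted f ψ m ε k l → L ≤ 2 ^ l * r.τ k →
        r.CallSucceeds f ψ m ε k l := fun l hl hLl =>
      (hr.call k l hl).succeeds hs hψ hf A1 hL hn hm hε hτpos hLl (hlarge l hl)
    have hex : ∃ l, r.CallSucceeds f ψ m ε k l := by
      by_contra! hcon
      obtain ⟨l, hl⟩ := pow_unbounded_of_one_lt (L / r.τ k) (one_lt_two : (1 : ℝ) < 2)
      -- If no call succeeded, every call would take place, including one with `L ≤ 2 ^ l * r.τ k`,
      -- which must succeed.
      exact hcon l (hsearch l ⟨hprev, fun l' _ => hcon l'⟩ ((div_lt_iff₀ hτpos).1 hl).le)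
    classical
    obtain ⟨l, hsucc, hmin⟩ : ∃ l, r.CallSucceeds f ψ m ε k l ∧
        ∀ l' < l, ¬ r.CallSucceeds f ψ m ε k l' :=
      ⟨Nat.find hex, Nat.find_spec hex, fun l' hl' => Nat.find_min hex hl'⟩
    have hexec : r.CallExecuted f ψ m ε k l := ⟨hprev, hmin⟩
    obtain ⟨hxn, hsn, hτn⟩ := hr.next k l hexec hsucc
    -- For `l > 0` the preceding call was halted, hence `2 ^ (l - 1) * r.τ k < L`; for `l = 0` the
    -- induction bound on `r.τ k` suffices.
    have hτl : 2 ^ l * r.τ k ≤ 2 * max τ₀ L := by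
      rcases Nat.eq_zero_or_pos l with rfl | hlpos
      · rw [pow_zero, one_mul]; linarith
      · obtain ⟨j, rfl⟩ : ∃ j, l = j + 1 := ⟨l - 1, by omega⟩
        have hj : ¬ L ≤ 2 ^ j * r.τ k := fun hcon =>
          hmin j (Nat.lt_succ_self j)
            (hsearch j ⟨hprev, fun l' hl' => hmin l' (hl'.trans (Nat.lt_succ_self j))⟩ hcon)
        have := le_max_right τ₀ L
        rw [pow_succ]
        linarith
    have hcall := hr.call k l hexec
    have hlarge' : ∀ t ≤ m, ε < ‖gradient f (r.y k l t) + r.p k l t‖ := fun t ht =>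
      hlarge l hexec t (hsucc.iterateComputed ht)
    have hLτ : L ≤ 45 * (2 ^ l * r.τ k) := by
      have h1 := le_mul_of_cgConst hL hτ₀_big
      have h2 : r.τ k ≤ 2 ^ l * r.τ k :=
        le_mul_of_one_le_left hτpos.le (one_le_pow₀ one_le_two)
      linarith
    have hhalf : ‖gradient f (r.x k) + r.s k‖ ≤ kappa μ L τ₀ m / 2 := by
      refine hG.trans ?_
      rw [div_eq_mul_one_div (kappa μ L τ₀ m) 2]
      refine mul_le_mul_of_nonneg_left ?_ hκ.le
      calc ((1 : ℝ) / 2) ^ (1 + m) ^ k ≤ (1 / 2) ^ 1 :=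
            pow_le_pow_of_le_one (by norm_num) (by norm_num) (Nat.one_le_pow _ _ (by omega))
        _ = 1 / 2 := pow_one _
    have hlast := hcall.norm_gradient_last_le hs hψ hf A1 hL hn hm hε hτpos hμ A2 hκ hκS
      (lipschitz_le_regParam hL) (regParam_le hτ₀ hτl) hLτ hhalf hsucc hlarge'
    refine ⟨fun k' hk' => ?_, ?_, ?_, ?_, ?_, ?_⟩
    · rcases Nat.lt_succ_iff_lt_or_eq.1 hk' with h | rfl
      · exact hprev k' h
      · exact ⟨l, hsucc⟩
    · rw [hτn]; exact le_max_left _ _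
    · rw [hτn]
      refine max_le (le_max_left _ _) ?_
      rw [zpow_sub_one₀ two_ne_zero, zpow_natCast]
      linarith
    · rw [hxn, hsn]
      exact hcall.mem_subdifferential hs (hsucc.iterateComputed le_rfl)
    · rw [hxn, hsn]
      exact (hlarge' m le_rfl).le
    · rw [hxn, hsn]
      refine le_of_mul_le_mul_left (hlast.trans ?_) (pow_pos hκ m)
      calc _ ≤ (kappa μ L τ₀ m * (1 / 2) ^ (1 + m) ^ k) ^ (m + 1) :=
            pow_le_pow_left₀ (norm_nonneg _) hG _
        _ = _ := by rw [mul_pow, ← pow_mul, pow_succ (1 + m) k, add_comm m 1]; ring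

end Outer

/-! ### From doubly exponential decay to the iteration count -/

lemma natCast_le_logb_logb {m N : ℕ} {ε κ : ℝ} (hm : 0 < m) (hε : 0 < ε)
    (h : ε ≤ κ * (1 / 2) ^ (1 + m) ^ N) :
    (N : ℝ) ≤ 1 / Real.logb 2 (1 + (m : ℝ)) * Real.logb 2 (Real.logb 2 (κ / ε)) := by
  have hm' : (0 : ℝ) < m := by exact_mod_cast hm
  have h1 : (2 : ℝ) ^ (1 + m) ^ N ≤ κ / ε := by
    rw [le_div_iff₀ hε]
    rw [one_div, inv_pow, ← div_eq_mul_inv, le_div_iff₀ (by positivity)] at h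
    linarith
  have h2 : ((1 + m : ℝ)) ^ N ≤ Real.logb 2 (κ / ε) := by
    rw [Real.le_logb_iff_rpow_le one_lt_two (lt_of_lt_of_le (by positivity) h1)]
    exact_mod_cast h1
  have h3 : N * Real.logb 2 (1 + m) ≤ Real.logb 2 (Real.logb 2 (κ / ε)) := by
    rw [← Real.logb_pow]
    exact Real.logb_le_logb_of_le one_lt_two (by positivity) h2
  have h4 : 0 < Real.logb 2 (1 + (m : ℝ)) := Real.logb_pos one_lt_two (by linarith)
  rw [one_div_mul_eq_div, le_div_iff₀ h4]
  exact h3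

end ZOCNM

open ZOCNM in
theorem mainTheorem9 (n : ℕ) (f : E n → ℝ) (ψ : E n → EReal) (L μ τ₀ ε : ℝ) (m : ℕ)
    (hf : ContDiff ℝ 2 f) (hψ : IsProperClosedConvex ψ)
    (hL : 0 ≤ L) (hμ : 0 < μ) (hτ₀ : 0 < τ₀) (hε : 0 < ε) (hm : 1 ≤ m)
    (A1 : HessianLipschitz f L)
    (A2 : HessianBoundedBelow f (effDomain ψ) μ)
    (hτ₀_big : 2 * cgConst ^ 2 * L / 3 ≤ τ₀)
    (x₀ s₀ : E n) (hx₀ : InLocalRegion f ψ ε (kappa μ L τ₀ m) x₀ s₀)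
    (r : Trace n) (hr : IsZeroOrderCNM f ψ x₀ s₀ τ₀ ε m r) :
    ∃ T : ℕ, IsLeast {k : ℕ | r.HitsAt f ψ m ε k} T ∧
      (T : ℝ) ≤ 1 / Real.logb 2 (1 + (m : ℝ)) *
        Real.logb 2 (Real.logb 2 (kappa μ L τ₀ m / ε)) + 1 := by
  -- In dimension zero every gradient norm vanishes, contradicting `0 < ε ≤ ‖∇f(x₀) + s₀‖`. Positive
  -- dimension makes the difference steps positive.
  have hn : 0 < n := by
    refine Nat.pos_of_ne_zero fun h0 => ?_
    subst h0
    have h1 := hx₀.le_norm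
    rw [Subsingleton.elim (gradient f x₀ + s₀) 0, norm_zero] at h1
    exact absurd hε (not_lt.2 h1)
  have bound : ∀ N, (∀ k < N, ¬ r.HitsAt f ψ m ε k) → (N : ℝ) ≤
      1 / Real.logb 2 (1 + (m : ℝ)) * Real.logb 2 (Real.logb 2 (kappa μ L τ₀ m / ε)) := by
    intro N hN
    obtain ⟨-, -, -, -, h1, h2⟩ := hr.convergence_before_hit hf hψ hL hμ hτ₀ hε hm hn A1 A2
      hτ₀_big hx₀ N hN
    exact natCast_le_logb_logb hm hε (h1.trans h2)
  have hex : ∃ k, r.HitsAt f ψ m ε k := by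
    by_contra! hcon
    obtain ⟨N, hN⟩ := exists_nat_gt
      (1 / Real.logb 2 (1 + (m : ℝ)) * Real.logb 2 (Real.logb 2 (kappa μ L τ₀ m / ε)))
    exact absurd hN (not_lt.2 (bound N fun k _ => hcon k))
  classical
  refine ⟨Nat.find hex, ⟨Nat.find_spec hex, fun k hk => Nat.find_min' hex hk⟩, ?_⟩
  -- Every iteration before the first hit is hit-free, so the bound applies to the first hit itself;
  -- the additional `1` is slack.
  have := bound (Nat.find hex) fun k hk => Nat.find_min hex hk
  linarith
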